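/- **Setting.** Let $\Gamma_1$ be an (additively written) abelian group with no element of order $2$, let $\Gamma=\Gamma_1\rtimes\{1,-1\}^\times$ with $-1$ acting by inversion, so $(a,b)(c,d)=(a+bc,\,bd)$, and identify $\Gamma_1$ with the normal subgroup $\{(a,1)\}$. Let $\mathcal A=\{\{(0,1),(a,-1)\}: a\in\Gamma_1\}$. Let $G$ be a finite graph (loops and parallel edges allowed) and let $\psi$ be a $\Gamma$-gain function on $G$: it assigns to each oriented edge $(e,u,v)$ an element of $\Gamma$, with $\psi(e,v,u)=\psi(e,u,v)^{-1}$ if $u\neq v$. For a walk $W=u_0,e_1,u_1,\dots,e_l,u_l$ put $\psi(W)=\prod_i\psi(e_i,u_{i-1},u_i)$; a cycle is $\psi$-balanced if some simple closed walk around it has $\psi(W)=1$. Let $\psi/\Gamma_1$ be the induced gain function with values in $\Gamma/\Gamma_1$. For $\eta:V(G)\to\Gamma$ put $\psi^\eta(e,u,v)=\eta(u)^{-1}\psi(e,u,v)\eta(v)$, and for $C\subseteq E(G)$ let $\psi^\eta(C)$ be the set of values of $\psi^\eta$ on all orientations of edges in $C$. A *handcuff* consists either of two edge-disjoint cycles with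 exactly one common vertex, or of two vertex-disjoint cycles with a minimal path connecting them; a *theta graph* consists of three internally disjoint paths with the same two distinct ends. The frame matroid $F=F(G,\psi/\Gamma_1)$ is the matroid on $E(G)$ whose circuits are the $(\psi/\Gamma_1)$-balanced cycles and the handcuffs and theta graphs all of whose cycles are not $(\psi/\Gamma_1)$-balanced. Let $\mathcal C=\mathcal C(\Gamma,\Gamma_1,\mathcal A,G,\psi)$ be the set of circuits $C$ of $F$ such that $C$ is a $\psi$-balanced cycle, or $C$ is a handcuff or theta graph and $\psi^\eta(C)\subseteq A$ for some $\eta:V(G)\to\Gamma$ and some $A\in\mathcal A$. Let $M(\Gamma,\Gamma_1,\mathcal A,G,\psi)$ be the elementary lift of $F$ given by $\mathcal C$, i.e. the matroid on $E(G)$ in which $X$ has rank $r_F(X)$ if every circuit of $F|X$ is in $\mathcal C$, and rank $r_F(X)+1$ otherwise. Write $\psi(e,u,v)=(\phi(e,u,v),\sigma(e))$, and for a walk $W$ as above put $\phi(W)=\sum_{i=1}^{l}\sigma(e_1)\cdots\sigma(e_{i-1})\,\phi(e_i,u_{i-1},u_i)$. A *circuit walk* for a circuit $C$ of $F$ is a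 closed walk on $C$ that traverses every edge of $C$ and traverses each edge that is in a cycle of $C$ exactly once. The circuit $C$ is *neutral* (Anderson–Su–Zaslavsky) if $\phi(W)=0$ for a circuit walk $W$ of $C$. The Anderson–Su–Zaslavsky matroid of $(G,\psi)$ is the matroid on $E(G)$ with rank function $r(X)=|V(G[X])|-b(X)+\delta(X)$, where $G[X]$ is the graph formed by the edges in $X$ and their ends, $b(X)$ is the number of components of $G[X]$ all of whose cycles are $(\psi/\Gamma_1)$-balanced, and $\delta(X)=0$ if every circuit of $F|X$ is neutral and $\delta(X)=1$ otherwise. **Statement.** The matroid $F$ exists. A circuit $C$ of $F$ is neutral if and only if $C\in\mathcal C(\Gamma,\Gamma_1,\mathcal A,G,\psi)$, and whether $\phi(W)=0$ does not depend on the circuit walk $W$ of $C$. The matroid $M(\Gamma,\Gamma_1,\mathcal A,G,\psi)$ and the Anderson–Su–Zaslavsky matroid of $(G,\psi)$ exist (their rank functions above are rank functions of matroids), and they are equal. -/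

import Mathlib

namespace GainGraph

/-! ### Walks, cycles, handcuffs and theta graphs in a multigraph -/

/-- A walk `u₀, e₁, u₁, …, e_l, u_l` in `G`, from `u₀` to `u_l`. -/
inductive Walk {α β : Type*} (G : Graph α β) : α → α → Type _
  | nil {v : α} (hv : v ∈ G.vertexSet) : Walk G v v
  | cons {u v w : α} (e : β) (h : G.IsLink e u v) (W : Walk G v w) : Walk G u w

namespace Walk

/-- The oriented edges `(e_i, u_{i-1}, u_i)` of a walk, in order. -/
def steps {α β : Type*} {G : Graph α β} : {u v : α} → Walk G u v → List (β × α × α)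
  | _, _, nil _ => []
  | u, _, cons (v := v) e _ W => (e, u, v) :: W.steps

/-- The list of edges `e₁, …, e_l` of a walk. -/
def edges {α β : Type*} {G : Graph α β} {u v : α} (W : Walk G u v) : List β :=
  W.steps.map fun s => s.1

/-- The list of vertices `u₁, …, u_l` of a walk, without the initial vertex. -/
def tailSupport {α β : Type*} {G : Graph α β} {u v : α} (W : Walk G u v) : List α :=
  W.steps.map fun s => s.2.2

/-- The list of vertices `u₀, …, u_l` of a walk. -/
def support {α β : Type*} {G : Graph α β} {u v : α} (W : Walk G u v) : List α :=
  u :: W.tailSupport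

/-- The set of edges of a walk. -/
def edgeSet {α β : Type*} {G : Graph α β} {u v : α} (W : Walk G u v) : Set β :=
  {e | e ∈ W.edges}

/-- A path: a walk without repeated vertices. -/
def IsPath {α β : Type*} {G : Graph α β} {u v : α} (W : Walk G u v) : Prop :=
  W.support.Nodup

/-- A simple closed walk: it has at least one edge, and it repeats neither an edge nor a vertex
(except that it ends where it starts). A loop gives such a walk of length one, a pair of parallel
edges one of length two. -/
def IsSimpleClosed {α β : Type*} {G : Graph α β} {v : α} (W : Walk G v v) : Prop :=
  W.edges ≠ [] ∧ W.edges.Nodup ∧ W.tailSupport.Nodup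

end Walk

/-- The vertices incident with an edge in `X`, i.e. the vertex set of `G[X]`. -/
def verts {α β : Type*} (G : Graph α β) (X : Set β) : Set α :=
  {v | ∃ e ∈ X, G.Inc e v}

/-- The graph `G[X]`, with edge set `X` and vertex set the vertices incident with an edge
in `X`. -/
def edgeInduced {α β : Type*} (G : Graph α β) (X : Set β) : Graph α β where
  vertexSet := verts G X
  IsLink e u v := e ∈ X ∧ G.IsLink e u v
  isLink_symm := fun _ _ => ⟨fun _ _ h => ⟨h.1, h.2.symm⟩⟩
  eq_or_eq_of_isLink_of_isLink := fun _ _ _ _ _ h h' =>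
    G.eq_or_eq_of_isLink_of_isLink h.2 h'.2
  left_mem_of_isLink := fun e _ v h => ⟨e, h.1, v, h.2⟩

/-- A set of edges is a cycle if it is the edge set of a simple closed walk. -/
def IsCycle {α β : Type*} (G : Graph α β) (C : Set β) : Prop :=
  ∃ (v : α) (W : Walk G v v), W.IsSimpleClosed ∧ W.edgeSet = C

/-- A tight handcuff: two edge-disjoint cycles with exactly one common vertex. -/
def IsTightHandcuff {α β : Type*} (G : Graph α β) (C : Set β) : Prop :=
  ∃ C₁ C₂ : Set β, IsCycle G C₁ ∧ IsCycle G C₂ ∧ Disjoint C₁ C₂ ∧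
    (∃ v, verts G C₁ ∩ verts G C₂ = {v}) ∧ C = C₁ ∪ C₂

/-- A loose handcuff: two vertex-disjoint cycles with a minimal path connecting them. -/
def IsLooseHandcuff {α β : Type*} (G : Graph α β) (C : Set β) : Prop :=
  ∃ C₁ C₂ : Set β, IsCycle G C₁ ∧ IsCycle G C₂ ∧ Disjoint (verts G C₁) (verts G C₂) ∧
    ∃ (u v : α) (P : Walk G u v), P.IsPath ∧
      {x | x ∈ P.support} ∩ verts G C₁ = {u} ∧ {x | x ∈ P.support} ∩ verts G C₂ = {v} ∧
      C = C₁ ∪ C₂ ∪ P.edgeSet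

/-- A handcuff: tight or loose. -/
def IsHandcuff {α β : Type*} (G : Graph α β) (C : Set β) : Prop :=
  IsTightHandcuff G C ∨ IsLooseHandcuff G C

/-- A theta graph: three paths with the same two distinct ends that are pairwise edge-disjoint
and share no vertex besides these ends. -/
def IsTheta {α β : Type*} (G : Graph α β) (C : Set β) : Prop :=
  ∃ (u v : α) (P : Fin 3 → Walk G u v), u ≠ v ∧ (∀ i, (P i).IsPath) ∧
    (∀ i j, i ≠ j → Disjoint (P i).edgeSet (P j).edgeSet ∧
      {x | x ∈ (P i).support} ∩ {x | x ∈ (P j).support} = {u, v}) ∧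
    C = ⋃ i, (P i).edgeSet

/-- The vertex sets of the connected components of a graph. -/
def IsComponent {α β : Type*} (H : Graph α β) (S : Set α) : Prop :=
  ∃ v ∈ H.vertexSet, S = {w | Nonempty (Walk H v w)}

/-- The matroid with the property `P`. -/
noncomputable def theMatroid {β : Type*} (P : Matroid β → Prop) : Matroid β :=
  @Classical.epsilon _ ⟨Matroid.emptyOn β⟩ P

/-! ### Gain functions -/

/-- A `Γ`-gain function for `G`: a value in `Γ` for each oriented edge `(e, u, v)`, such that
reversing the orientation of an edge that is not a loop inverts the value. Only the values `val e u v`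
with `G.IsLink e u v` have a meaning. -/
structure GainFunction {α β : Type*} (G : Graph α β) (Γ : Type*) [Group Γ] where
  val : β → α → α → Γ
  val_swap : ∀ e u v, G.IsLink e u v → u ≠ v → val e v u = (val e u v)⁻¹

namespace GainFunction

/-- The gain of a walk: the product of the gains of its oriented edges, in order. -/
def walkVal {α β : Type*} {G : Graph α β} {Γ : Type*} [Group Γ] (ψ : GainFunction G Γ)
    {u v : α} (W : Walk G u v) : Γ :=
  (W.steps.map fun s => ψ.val s.1 s.2.1 s.2.2).prod

/-- The switched gain function `ψ^η`, with `ψ^η(e, u, v) = η(u)⁻¹ ψ(e, u, v) η(v)`. -/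
def switch {α β : Type*} {G : Graph α β} {Γ : Type*} [Group Γ] (ψ : GainFunction G Γ)
    (η : α → Γ) : GainFunction G Γ where
  val e u v := (η u)⁻¹ * ψ.val e u v * η v
  val_swap e u v h huv := by rw [ψ.val_swap e u v h huv]; group

/-- The quotient gain function `ψ/Γ₁`. -/
def quot {α β : Type*} {G : Graph α β} {Γ : Type*} [Group Γ] (ψ : GainFunction G Γ)
    (Γ₁ : Subgroup Γ) [Γ₁.Normal] : GainFunction G (Γ ⧸ Γ₁) where
  val e u v := (ψ.val e u v : Γ ⧸ Γ₁)
  val_swap e u v h huv := by rw [ψ.val_swap e u v h huv]; rfl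

/-- `ψ(X)`, the set of gains of all orientations of the edges in `X`. -/
def valSet {α β : Type*} {G : Graph α β} {Γ : Type*} [Group Γ] (ψ : GainFunction G Γ)
    (X : Set β) : Set Γ :=
  {g | ∃ e ∈ X, ∃ u v, G.IsLink e u v ∧ g = ψ.val e u v}

/-- `C` is a `ψ`-balanced cycle: some simple closed walk around `C` has gain `1`. -/
def IsBalancedCycle {α β : Type*} {G : Graph α β} {Γ : Type*} [Group Γ] (ψ : GainFunction G Γ)
    (C : Set β) : Prop :=
  ∃ (v : α) (W : Walk G v v), W.IsSimpleClosed ∧ W.edgeSet = C ∧ ψ.walkVal W = 1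

/-- The circuits of the frame matroid: the balanced cycles, and the handcuffs and theta graphs
all of whose cycles are unbalanced. -/
def IsFrameCircuit {α β : Type*} {G : Graph α β} {Γ : Type*} [Group Γ] (ψ : GainFunction G Γ)
    (C : Set β) : Prop :=
  ψ.IsBalancedCycle C ∨
    ((IsHandcuff G C ∨ IsTheta G C) ∧ ∀ D ⊆ C, IsCycle G D → ¬ ψ.IsBalancedCycle D)

/-- The matroids on the edge set of `G` whose circuits are the frame circuits (there is at most
one, a matroid being determined by its circuits). -/
def IsFrameMatroid {α β : Type*} {G : Graph α β} {Γ : Type*} [Group Γ] (ψ : GainFunction G Γ)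
    (N : Matroid β) : Prop :=
  N.E = G.edgeSet ∧ ∀ C, N.IsCircuit C ↔ ψ.IsFrameCircuit C

/-- The frame matroid `F(G, ψ)`. -/
noncomputable def frameMatroid {α β : Type*} {G : Graph α β} {Γ : Type*} [Group Γ]
    (ψ : GainFunction G Γ) : Matroid β :=
  theMatroid ψ.IsFrameMatroid

/-- The number of `ψ`-balanced components of `G[X]`. -/
noncomputable def numBalancedComponents {α β : Type*} {G : Graph α β} {Γ : Type*} [Group Γ]
    (ψ : GainFunction G Γ) (X : Set β) : ℕ :=
  Set.ncard {S : Set α | IsComponent (edgeInduced G X) S ∧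
    ∀ C ⊆ X, IsCycle G C → verts G C ⊆ S → ψ.IsBalancedCycle C}

/-- The set `𝒞(Γ, Γ₁, 𝒜, G, ψ)` of circuits of `F(G, ψ/Γ₁)`. -/
def linearClass {α β : Type*} {G : Graph α β} {Γ : Type*} [Group Γ] (Γ₁ : Subgroup Γ)
    [Γ₁.Normal] (𝒜 : Set (Subgroup Γ)) (ψ : GainFunction G Γ) : Set (Set β) :=
  {C | (ψ.quot Γ₁).IsFrameCircuit C ∧
    (ψ.IsBalancedCycle C ∨
      ((IsHandcuff G C ∨ IsTheta G C) ∧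
        ∃ η : α → Γ, ∃ A ∈ 𝒜, (ψ.switch η).valSet C ⊆ (A : Set Γ)))}

end GainFunction

/-! ### Matroids given by a rank function, and elementary lifts -/

/-- The rank of `X` in `M`, for a matroid `M` on a finite ground set. -/
noncomputable def rank {β : Type*} (M : Matroid β) (X : Set β) : ℤ :=
  ((M.eRk X).toNat : ℤ)

/-- `M` is a matroid with ground set `E` and rank function `r` (there is at most one for finite
`E`, a matroid being determined by its rank function). -/
def HasRankFunction {β : Type*} (E : Set β) (r : Set β → ℤ) (M : Matroid β) : Prop :=
  M.E = E ∧ ∀ X ⊆ E, rank M X = r X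

open Classical in
/-- The rank function of the elementary lift of `N` given by a linear class `𝒞` of circuits
of `N`. -/
noncomputable def liftRank {β : Type*} (N : Matroid β) (𝒞 : Set (Set β)) (X : Set β) : ℤ :=
  rank N X + if ∀ C, (N.restrict X).IsCircuit C → C ∈ 𝒞 then 0 else 1

namespace GainFunction

/-- The matroid `M(Γ, Γ₁, 𝒜, G, ψ)`: the elementary lift of the frame matroid `F(G, ψ/Γ₁)` given
by the class `𝒞(Γ, Γ₁, 𝒜, G, ψ)`. -/
noncomputable def liftMatroid {α β : Type*} {G : Graph α β} {Γ : Type*} [Group Γ]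
    (Γ₁ : Subgroup Γ) [Γ₁.Normal] (𝒜 : Set (Subgroup Γ)) (ψ : GainFunction G Γ) : Matroid β :=
  theMatroid
    (HasRankFunction G.edgeSet (liftRank (ψ.quot Γ₁).frameMatroid (ψ.linearClass Γ₁ 𝒜)))

end GainFunction

/-! ### The group `Γ₁ ⋊ {1, -1}` -/

/-- The action of `{1, -1}` on an abelian group in which `-1` acts by inversion. -/
def signAction (Γ₁ : Type*) [CommGroup Γ₁] : ℤˣ →* MulAut Γ₁ where
  toFun s :=
    { toFun := fun a => a ^ (s : ℤ)
      invFun := fun a => a ^ (s : ℤ)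
      left_inv := fun a => by
        change (a ^ (s : ℤ)) ^ (s : ℤ) = a
        rw [← zpow_mul, ← Units.val_mul, Int.units_mul_self, Units.val_one, zpow_one]
      right_inv := fun a => by
        change (a ^ (s : ℤ)) ^ (s : ℤ) = a
        rw [← zpow_mul, ← Units.val_mul, Int.units_mul_self, Units.val_one, zpow_one]
      map_mul' := fun a b => mul_zpow a b _ }
  map_one' := by ext a; exact zpow_one a
  map_mul' s t := by
    ext a
    change a ^ ((s * t : ℤˣ) : ℤ) = (a ^ (t : ℤ)) ^ (s : ℤ)
    rw [← zpow_mul, Units.val_mul, mul_comm]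

/-- The semidirect product `Γ₁ ⋊ {1, -1}`, in which `-1` acts on `Γ₁` by inversion. -/
abbrev SignedGroup (Γ₁ : Type*) [CommGroup Γ₁] : Type _ :=
  SemidirectProduct Γ₁ ℤˣ (signAction Γ₁)

/-- `Γ₁`, as the subgroup `{(a, 1) : a ∈ Γ₁}` of `Γ₁ ⋊ {1, -1}`. -/
def translations (Γ₁ : Type*) [CommGroup Γ₁] : Subgroup (SignedGroup Γ₁) :=
  (SemidirectProduct.inl : Γ₁ →* SignedGroup Γ₁).range

instance translations_normal (Γ₁ : Type*) [CommGroup Γ₁] : (translations Γ₁).Normal := by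
  unfold translations
  rw [SemidirectProduct.range_inl_eq_ker_rightHom]
  infer_instance

/-- The collection `𝒜` of the subgroups `{(1, 1), (a, -1)}` of `Γ₁ ⋊ {1, -1}`, for `a ∈ Γ₁`. -/
def reflectionSubgroups (Γ₁ : Type*) [CommGroup Γ₁] : Set (Subgroup (SignedGroup Γ₁)) :=
  {A | ∃ a : Γ₁, (A : Set (SignedGroup Γ₁)) = {1, ⟨a, -1⟩}}

/-! ### The matroid of a gain signed graph -/

namespace GainFunction

/-- The component `φ(e, u, v)` of `ψ(e, u, v) = (φ(e, u, v), σ(e))`. -/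
def gainPart {α β : Type*} {G : Graph α β} {Γ₁ : Type*} [CommGroup Γ₁]
    (ψ : GainFunction G (SignedGroup Γ₁)) (s : β × α × α) : Γ₁ :=
  (ψ.val s.1 s.2.1 s.2.2).left

/-- The component `σ(e)` of `ψ(e, u, v) = (φ(e, u, v), σ(e))`. It does not depend on the
orientation of `e`. -/
def signPart {α β : Type*} {G : Graph α β} {Γ₁ : Type*} [CommGroup Γ₁]
    (ψ : GainFunction G (SignedGroup Γ₁)) (s : β × α × α) : ℤˣ :=
  (ψ.val s.1 s.2.1 s.2.2).right

/-- The gain `φ(W)` of a walk `W = u₀, e₁, u₁, …, e_l, u_l` in a gain signed graph. In additive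
notation it is `∑ i, σ(e₁) ⋯ σ(e_{i-1}) φ(e_i, u_{i-1}, u_i)`; here `Γ₁` is written
multiplicatively. -/
def signedWalkGain {α β : Type*} {G : Graph α β} {Γ₁ : Type*} [CommGroup Γ₁]
    (ψ : GainFunction G (SignedGroup Γ₁)) {u v : α} (W : Walk G u v) : Γ₁ :=
  ∏ i : Fin W.steps.length,
    ψ.gainPart (W.steps.get i) ^ ((((W.steps.take i).map ψ.signPart).prod : ℤˣ) : ℤ)

end GainFunction

open Classical in
/-- A circuit walk for `C`: a closed walk on `C` that traverses every edge of `C`, and traverses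
each edge that lies in a cycle of `C` exactly once. -/
def IsCircuitWalk {α β : Type*} {G : Graph α β} (C : Set β) {v : α} (W : Walk G v v) : Prop :=
  W.edgeSet = C ∧ ∀ D ⊆ C, IsCycle G D → ∀ e ∈ D, W.edges.count e = 1

namespace GainFunction

/-- `C` is neutral: it has trivial gain, the gain being `φ(W)` for a circuit walk `W`. -/
def IsNeutral {α β : Type*} {G : Graph α β} {Γ₁ : Type*} [CommGroup Γ₁]
    (ψ : GainFunction G (SignedGroup Γ₁)) (C : Set β) : Prop :=
  ∃ (v : α) (W : Walk G v v), IsCircuitWalk C W ∧ ψ.signedWalkGain W = 1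

open Classical in
/-- The function `r(X) = |V(G[X])| - b(X) + δ(X)`, where `b(X)` is the number of balanced
components of `G[X]`, and `δ(X)` is `0` if every circuit of the restriction of the frame matroid
to `X` is neutral and `1` otherwise. -/
noncomputable def gainSignedRank {α β : Type*} {G : Graph α β} {Γ₁ : Type*} [CommGroup Γ₁]
    (ψ : GainFunction G (SignedGroup Γ₁)) (X : Set β) : ℤ :=
  ((verts G X).ncard : ℤ) - ((ψ.quot (translations Γ₁)).numBalancedComponents X : ℤ) +
    if ∀ C, ((ψ.quot (translations Γ₁)).frameMatroid.restrict X).IsCircuit C → ψ.IsNeutral C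
    then 0 else 1

/-- The Anderson–Su–Zaslavsky matroid of a gain signed graph: the matroid on the edge set of `G`
with rank function `gainSignedRank`. -/
noncomputable def gainSignedMatroid {α β : Type*} {G : Graph α β} {Γ₁ : Type*} [CommGroup Γ₁]
    (ψ : GainFunction G (SignedGroup Γ₁)) : Matroid β :=
  theMatroid (HasRankFunction G.edgeSet ψ.gainSignedRank)

end GainFunction

end GainGraph

/-! The quotient of `Γ₁ ⋊ {1, -1}` by `Γ₁` is the sign group, so `F` is the frame matroid of the
signed graph with signs `σ`. It is represented over `ℚ` by the signed incidence matrix, whose column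
for an edge `e` from `u` to `v` is the difference of `u` and `σ(e) v`. Two of the three paths of a
theta graph have equal sign, so the circuits of `F` are just the positive cycles and the handcuffs
with two negative cycles. Each circuit `C` carries an integral vector `z_C` in the kernel of the
boundary map, with entries ±1 on cycles and ±2 on a connecting path; every integral kernel vector
supported on `C` is a multiple of `z_C` (`IsSignedCircuit.exists_vector`). Conversely, every nonzero
kernel vector has a circuit in its support (`exists_isSignedCircuit_of_boundary_eq_zero`).

The gain `φ` extends linearly to integral chains, and `φ(W)` is the gain of the chain of `W`
(`chainGain_chain`). A parity argument shows that circuit walks have sign 1. The chain of such a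
walk is then a multiple of `z_C`, and it is `±z_C` because some edge is traversed once. Hence `C` is
neutral exactly when `z_C` has trivial gain, whatever the walk.

For a positive cycle this is balance. For a handcuff, triviality of the gain of `W₁ P W₂ P⁻¹` allows
a switching that trivializes the path and puts the gains on both cycles into the group of order two
generated by the reflection `ψ(W₁)`. Conversely, if all gains lie in such a group after switching,
so does the gain of a circuit walk; its sign is 1, so it is trivial
(`isNeutral_iff_mem_linearClass`).

For the lift to be a matroid, neutrality must be preserved when two elements `e, f` of the closure
of `X` are added together, given that it holds for each alone. From `2z`, for `z` the vector of a
circuit in `X ∪ {e, f}`, one subtracts multiples of vectors of neutral circuits through `e` and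
through `f`, and is left with a chain in `X`. The same elimination shows that chains in `X` in the
kernel have trivial gain. Both times one obtains that twice a gain vanishes, which suffices in the
absence of elements of order 2. Finally, `r_F(X) = |V(G[X])| - b(X)`, because the vectors orthogonal
to the columns of `X` have one free parameter per balanced component; so the two rank functions
agree. -/

namespace GainGraph

/-! ### Walks, paths and simple closed walks -/

namespace Walk

variable {α β : Type*} {G : Graph α β}

/-- Concatenation of walks. -/
def append : {u v w : α} → Walk G u v → Walk G v w → Walk G u w
  | _, _, _, nil _, W' => W'
  | _, _, _, cons e h W, W' => cons e h (W.append W')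

/-- The walk that traverses a single edge. -/
def single {u v : α} (e : β) (h : G.IsLink e u v) : Walk G u v :=
  cons e h (nil h.right_mem)

/-- The reverse of a walk. -/
def reverse : {u v : α} → Walk G u v → Walk G v u
  | _, _, nil hv => nil hv
  | _, _, cons e h W => W.reverse.append (single e h.symm)

section basic

variable {u v w x : α}

@[simp] lemma steps_nil (hv : v ∈ G.vertexSet) : (nil hv).steps = [] := by
  simp [steps]

@[simp] lemma steps_cons (e : β) (h : G.IsLink e u v) (W : Walk G v w) :
    (cons e h W).steps = (e, u, v) :: W.steps := by
  simp [steps]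

@[simp] lemma edges_nil (hv : v ∈ G.vertexSet) : (nil hv).edges = [] := by
  simp [edges]

@[simp] lemma edges_cons (e : β) (h : G.IsLink e u v) (W : Walk G v w) :
    (cons e h W).edges = e :: W.edges := by
  simp [edges]

@[simp] lemma tailSupport_nil (hv : v ∈ G.vertexSet) : (nil hv).tailSupport = [] := by
  simp [tailSupport]

@[simp] lemma tailSupport_cons (e : β) (h : G.IsLink e u v) (W : Walk G v w) :
    (cons e h W).tailSupport = W.support := by
  simp [tailSupport, support]

lemma support_eq (W : Walk G u v) : W.support = u :: W.tailSupport := rfl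

@[simp] lemma support_nil (hv : v ∈ G.vertexSet) : (nil hv).support = [v] := by
  simp [support]

@[simp] lemma support_cons (e : β) (h : G.IsLink e u v) (W : Walk G v w) :
    (cons e h W).support = u :: W.support := by
  simp [support_eq (cons e h W)]

@[simp] lemma mem_edgeSet {W : Walk G u v} {e : β} : e ∈ W.edgeSet ↔ e ∈ W.edges := Iff.rfl

@[simp] lemma steps_append (A : Walk G u v) (B : Walk G v w) :
    (A.append B).steps = A.steps ++ B.steps := by
  induction A with
  | nil => simp [append]
  | cons e h W ih => simp [append, ih]

@[simp] lemma edges_append (A : Walk G u v) (B : Walk G v w) :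
    (A.append B).edges = A.edges ++ B.edges := by
  simp [edges]

@[simp] lemma tailSupport_append (A : Walk G u v) (B : Walk G v w) :
    (A.append B).tailSupport = A.tailSupport ++ B.tailSupport := by
  simp [tailSupport]

lemma support_append (A : Walk G u v) (B : Walk G v w) :
    (A.append B).support = A.support ++ B.tailSupport := by
  simp [support_eq]

@[simp] lemma edges_single (e : β) (h : G.IsLink e u v) : (single e h).edges = [e] := by
  simp [single]

@[simp] lemma tailSupport_single (e : β) (h : G.IsLink e u v) :
    (single e h).tailSupport = [v] := by
  simp [single]

@[simp] lemma support_single (e : β) (h : G.IsLink e u v) : (single e h).support = [u, v] := by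
  simp [single]

@[simp] lemma edges_reverse (W : Walk G u v) : W.reverse.edges = W.edges.reverse := by
  induction W with
  | nil => simp [reverse]
  | cons e h W ih => simp [reverse, ih]

@[simp] lemma support_reverse (W : Walk G u v) : W.reverse.support = W.support.reverse := by
  induction W with
  | nil => simp [reverse]
  | cons e h W ih => simp [reverse, support_append, ih]

lemma start_mem_support (W : Walk G u v) : u ∈ W.support := by
  simp [support_eq]

lemma end_mem_support (W : Walk G u v) : v ∈ W.support := by
  induction W with
  | nil => simp
  | cons e h W ih => simp [ih]

lemma mem_support_of_mem_tailSupport {W : Walk G u v} (h : x ∈ W.tailSupport) :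
    x ∈ W.support := by
  simp [support_eq, h]

lemma mem_tailSupport_of_ne {W : Walk G u v} (h : x ∈ W.support) (hx : x ≠ u) :
    x ∈ W.tailSupport := by
  simpa [support_eq, hx] using h

lemma end_mem_tailSupport {W : Walk G u v} (h : W.edges ≠ []) : v ∈ W.tailSupport := by
  cases W with
  | nil => simp at h
  | cons e h W => simpa using W.end_mem_support

lemma exists_append_of_mem_support {W : Walk G u v} (h : x ∈ W.support) :
    ∃ (A : Walk G u x) (B : Walk G x v), W = A.append B := by
  induction W with
  | nil hv =>
    obtain rfl : x = _ := by simpa using h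
    exact ⟨nil hv, nil hv, rfl⟩
  | @cons u _ _ e he W ih =>
    by_cases hx : x = u
    · subst hx
      exact ⟨nil he.left_mem, cons e he W, rfl⟩
    · obtain ⟨A, B, rfl⟩ := ih (by simpa [hx] using h)
      exact ⟨cons e he A, B, rfl⟩

lemma of_mem_steps {W : Walk G u v} {e : β} {a b : α} (h : (e, a, b) ∈ W.steps) :
    G.IsLink e a b ∧ a ∈ W.support ∧ b ∈ W.tailSupport ∧ e ∈ W.edges := by
  induction W with
  | nil => simp at h
  | cons f hf W ih =>
    simp only [steps_cons, List.mem_cons, Prod.mk.injEq] at h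
    rcases h with ⟨rfl, rfl, rfl⟩ | h
    · simpa using ⟨hf, W.start_mem_support⟩
    · obtain ⟨h1, h2, h3, h4⟩ := ih h
      simp [h1, h2, h4, mem_support_of_mem_tailSupport h3]

lemma exists_step {W : Walk G u v} {e : β} (h : e ∈ W.edges) :
    ∃ a b, (e, a, b) ∈ W.steps := by
  simpa [edges] using h

lemma mem_support_of_isLink {W : Walk G u v} {e : β} {a b : α} (he : e ∈ W.edges)
    (h : G.IsLink e a b) : a ∈ W.support := by
  obtain ⟨c, d, hs⟩ := exists_step he
  obtain ⟨h1, h2, h3, -⟩ := of_mem_steps hs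
  rcases h.left_eq_or_eq h1 with rfl | rfl
  · exact h2
  · exact mem_support_of_mem_tailSupport h3

lemma edgeSet_subset (W : Walk G u v) : W.edgeSet ⊆ G.edgeSet := by
  intro e he
  obtain ⟨c, d, hs⟩ := exists_step he
  exact (of_mem_steps hs).1.edge_mem

lemma verts_edgeSet_subset (W : Walk G u v) : verts G W.edgeSet ⊆ {x | x ∈ W.support} := by
  rintro x ⟨e, he, y, hxy⟩
  exact mem_support_of_isLink he hxy

lemma verts_edgeSet {W : Walk G u v} (hW : W.edges ≠ []) :
    verts G W.edgeSet = {x | x ∈ W.support} := by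
  refine W.verts_edgeSet_subset.antisymm ?_
  induction W with
  | nil => simp at hW
  | @cons u v w e h W ih =>
    intro x hx
    simp only [support_cons, List.mem_cons, Set.mem_ofPred_eq] at hx
    rcases hx with rfl | hx
    · exact ⟨e, by simp, _, h⟩
    · by_cases hW' : W.edges = []
      · cases W with
        | nil =>
          obtain rfl : x = v := by simpa using hx
          exact ⟨e, by simp, _, h.symm⟩
        | cons => simp at hW'
      · obtain ⟨f, hf, hfx⟩ := ih hW' hx
        exact ⟨f, by simp only [mem_edgeSet] at hf; simp [hf], hfx⟩

end basic

section paths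

variable {u v w x : α}

lemma isPath_cons {e : β} {h : G.IsLink e u v} {W : Walk G v w} :
    (cons e h W).IsPath ↔ u ∉ W.support ∧ W.IsPath := by
  simp [IsPath]

lemma IsPath.notMem_edges_of_cons {e f : β} {h : G.IsLink e u v} {W : Walk G v w}
    (hP : (cons e h W).IsPath) (hf : G.Inc f u) : f ∉ W.edges := by
  obtain ⟨y, hy⟩ := hf
  exact fun hf => (isPath_cons.1 hP).1 (mem_support_of_isLink hf hy)

lemma IsPath.edges_nodup {W : Walk G u v} (hW : W.IsPath) : W.edges.Nodup := by
  induction W with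
  | nil => simp
  | cons e h W ih =>
    simp only [edges_cons, List.nodup_cons]
    exact ⟨hW.notMem_edges_of_cons h.inc_left, ih (isPath_cons.1 hW).2⟩

lemma IsPath.reverse {W : Walk G u v} (hW : W.IsPath) : W.reverse.IsPath := by
  simpa [IsPath] using hW

lemma IsPath.tailSupport_nodup {W : Walk G u v} (hW : W.IsPath) : W.tailSupport.Nodup := by
  rw [IsPath, support_eq] at hW
  exact hW.of_cons

lemma IsPath.start_notMem {W : Walk G u v} (hW : W.IsPath) : u ∉ W.tailSupport := by
  rw [IsPath, support_eq] at hW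
  exact (List.nodup_cons.1 hW).1

lemma isPath_append {A : Walk G u v} {B : Walk G v w} :
    (A.append B).IsPath ↔ A.IsPath ∧ B.IsPath ∧
      ∀ x ∈ A.support, x ∈ B.support → x = v := by
  constructor
  · intro h
    rw [IsPath, support_append, List.nodup_append] at h
    obtain ⟨hA, hB, hAB⟩ := h
    refine ⟨hA, ?_, ?_⟩
    · rw [IsPath, support_eq, List.nodup_cons]
      exact ⟨fun hv => hAB v A.end_mem_support v hv rfl, hB⟩
    · intro x hx hxB
      by_contra hne
      exact hAB x hx x (mem_tailSupport_of_ne hxB hne) rfl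
  · rintro ⟨hA, hB, hAB⟩
    rw [IsPath, support_append, List.nodup_append]
    refine ⟨hA, hB.tailSupport_nodup, ?_⟩
    rintro x hx _ hxB rfl
    obtain rfl := hAB x hx (mem_support_of_mem_tailSupport hxB)
    exact hB.start_notMem hxB

lemma isPath_single {e : β} {h : G.IsLink e u v} (huv : u ≠ v) : (single e h).IsPath := by
  simpa [IsPath] using huv

lemma edges_ne_nil_of_ne {W : Walk G u v} (h : u ≠ v) : W.edges ≠ [] := by
  cases W with
  | nil => exact absurd rfl h
  | cons => simp

/-- A path meeting an edge between its two ends consists of this edge alone. -/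
lemma IsPath.edges_eq_singleton {W : Walk G u v} (hW : W.IsPath) (huv : u ≠ v) {e : β}
    (he : e ∈ W.edges) (h : G.IsLink e u v) : W.edges = [e] := by
  cases W with
  | nil => exact absurd rfl huv
  | @cons _ y _ f hf W =>
    have hef : e = f := by
      by_contra hef
      exact hW.notMem_edges_of_cons h.inc_left (by simpa [hef] using he)
    subst hef
    obtain rfl := hf.right_unique h
    cases W with
    | nil => simp
    | cons g hg W =>
      exact absurd W.end_mem_support (isPath_cons.1 (isPath_cons.1 hW).2).1

/-- Reduces cycles to paths. The condition on `e` only excludes the walk that returns along `e`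
itself. -/
lemma isSimpleClosed_cons {e : β} {h : G.IsLink e u v} {W : Walk G v u} :
    (cons e h W).IsSimpleClosed ↔ W.IsPath ∧ e ∉ W.edges := by
  constructor
  · rintro ⟨-, h2, h3⟩
    simp only [edges_cons, List.nodup_cons, tailSupport_cons] at h2 h3
    exact ⟨h3, h2.1⟩
  · rintro ⟨h1, h2⟩
    refine ⟨by simp, ?_, by rwa [tailSupport_cons]⟩
    simpa [h2] using h1.edges_nodup

lemma isSimpleClosed_of_perm {W : Walk G u u} {W' : Walk G v v} (hW : W.IsSimpleClosed)
    (he : W.edges.Perm W'.edges) (ht : W.tailSupport.Perm W'.tailSupport) :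
    W'.IsSimpleClosed := by
  obtain ⟨h1, h2, h3⟩ := hW
  refine ⟨fun h => h1 ?_, he.nodup h2, ht.nodup h3⟩
  rw [h] at he
  exact he.eq_nil

lemma IsSimpleClosed.verts {W : Walk G u u} (hW : W.IsSimpleClosed) :
    verts G W.edgeSet = {x | x ∈ W.support} :=
  verts_edgeSet hW.1

lemma edgeSet_eq_of_perm {u' v' : α} {W : Walk G u v} {W' : Walk G u' v'}
    (he : W.edges.Perm W'.edges) : W.edgeSet = W'.edgeSet := by
  ext e
  simp [he.mem_iff]

/-- A simple closed walk can be rotated to start at any of its vertices. -/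
lemma IsSimpleClosed.rotate {W : Walk G u u} (hW : W.IsSimpleClosed) (hx : x ∈ W.support) :
    ∃ W' : Walk G x x, W'.IsSimpleClosed ∧ W.edges.Perm W'.edges := by
  obtain ⟨A, B, rfl⟩ := exists_append_of_mem_support hx
  have he : (A.append B).edges.Perm (B.append A).edges := by
    simpa using List.perm_append_comm
  refine ⟨B.append A, isSimpleClosed_of_perm hW he ?_, he⟩
  simpa using List.perm_append_comm

lemma IsSimpleClosed.append_paths {A : Walk G u v} {B : Walk G v u}
    (h : (A.append B).IsSimpleClosed) (huv : u ≠ v) : A.IsPath ∧ B.IsPath := by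
  obtain ⟨-, -, h⟩ := h
  rw [tailSupport_append, List.nodup_append] at h
  obtain ⟨hA, hB, hAB⟩ := h
  constructor
  · rw [IsPath, support_eq, List.nodup_cons]
    exact ⟨fun hu => hAB u hu u (end_mem_tailSupport (edges_ne_nil_of_ne huv.symm)) rfl, hA⟩
  · rw [IsPath, support_eq, List.nodup_cons]
    exact ⟨fun hv => hAB v (end_mem_tailSupport (edges_ne_nil_of_ne huv)) v hv rfl, hB⟩

/-- Two internally disjoint paths with the same distinct ends form a cycle. -/
lemma isSimpleClosed_append {P : Walk G u v} {Q : Walk G v u} (huv : u ≠ v) (hP : P.IsPath)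
    (hQ : Q.IsPath) (he : Disjoint P.edgeSet Q.edgeSet)
    (hs : ∀ x ∈ P.support, x ∈ Q.support → x = u ∨ x = v) :
    (P.append Q).IsSimpleClosed := by
  refine ⟨by simp [edges_ne_nil_of_ne huv], ?_, ?_⟩
  · rw [edges_append, List.nodup_append]
    refine ⟨hP.edges_nodup, hQ.edges_nodup, ?_⟩
    rintro e heP _ heQ rfl
    exact Set.disjoint_left.1 he heP heQ
  · rw [tailSupport_append, List.nodup_append]
    refine ⟨hP.tailSupport_nodup, hQ.tailSupport_nodup, ?_⟩
    rintro x hxP _ hxQ rfl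
    rcases hs x (mem_support_of_mem_tailSupport hxP) (mem_support_of_mem_tailSupport hxQ) with
      rfl | rfl
    · exact hP.start_notMem hxP
    · exact hQ.start_notMem hxQ

end paths

end Walk

open Walk

/-! ### Vertex sets of edge sets, and maximal paths -/

section verts

variable {α β : Type*} {G : Graph α β}

lemma verts_mono {X Y : Set β} (h : X ⊆ Y) : verts G X ⊆ verts G Y := by
  rintro v ⟨e, he, hv⟩
  exact ⟨e, h he, hv⟩

lemma IsCycle.subset_edgeSet {C : Set β} (hC : IsCycle G C) : C ⊆ G.edgeSet := by
  obtain ⟨v, W, -, rfl⟩ := hC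
  exact W.edgeSet_subset

lemma IsCycle.nonempty {C : Set β} (hC : IsCycle G C) : C.Nonempty := by
  obtain ⟨v, W, hW, rfl⟩ := hC
  exact List.exists_mem_of_ne_nil _ hW.1

lemma IsCycle.exists_walk {C : Set β} (hC : IsCycle G C) {v : α} (hv : v ∈ verts G C) :
    ∃ W : Walk G v v, W.IsSimpleClosed ∧ W.edgeSet = C := by
  obtain ⟨u, W, hW, rfl⟩ := hC
  rw [hW.verts] at hv
  obtain ⟨W', hW', hp⟩ := hW.rotate hv
  exact ⟨W', hW', (edgeSet_eq_of_perm hp).symm⟩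

lemma verts_finite {X : Set β} (hX : X.Finite) : (verts G X).Finite := by
  have : verts G X = ⋃ e ∈ X, {v | G.Inc e v} := by
    ext v
    simp [verts]
  rw [this]
  refine hX.biUnion fun e _ => ?_
  by_cases he : ∃ a b, G.IsLink e a b
  · obtain ⟨a, b, h⟩ := he
    refine (Set.toFinite {a, b}).subset fun v hv => ?_
    simpa using Graph.Inc.eq_or_eq_of_isLink hv h
  · convert Set.finite_empty
    ext v
    simp only [Set.mem_ofPred_eq, Set.mem_empty_iff_false, iff_false]
    rintro ⟨w, hw⟩
    exact he ⟨_, _, hw⟩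

end verts

/-- Every walk in the finite edge set `X` that starts with a path `P` avoiding `S` can be continued
until it meets `S` or itself, if `X` has no dead ends. -/
lemma exists_maximal_path {α β : Type*} {G : Graph α β} {X : Set β} (hX : X.Finite)
    (hXG : ∀ e ∈ X, ∀ v, G.Inc e v → ∃ f ∈ X, f ≠ e ∧ G.Inc f v) (S : Set α) {a v : α}
    (P : Walk G a v) (hP : P.IsPath) (hPX : P.edgeSet ⊆ X) (hne : P.edges ≠ [])
    (hPS : ∀ x ∈ P.tailSupport, x ∉ S) :
    ∃ (t : α) (Q : Walk G a t) (f : β) (y : α), Q.IsPath ∧ Q.edgeSet ⊆ X ∧ Q.edges ≠ [] ∧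
      (∀ x ∈ Q.tailSupport, x ∉ S) ∧ f ∈ X ∧ f ∉ Q.edges ∧ G.IsLink f t y ∧
      (y ∈ S ∨ y ∈ Q.support) := by
  -- A path in `X` has at most `X.ncard` edges, so `k` bounds the number of further extensions.
  obtain ⟨k, hk⟩ : ∃ k, X.ncard < P.edges.length + k := ⟨X.ncard + 1, by omega⟩
  induction k generalizing v with
  | zero =>
    exfalso
    classical
    have h1 : P.edges.toFinset.card = P.edges.length :=
      List.toFinset_card_of_nodup hP.edges_nodup
    have h2 : P.edges.toFinset.card ≤ X.ncard := by
      rw [← Set.ncard_coe_finset]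
      exact Set.ncard_le_ncard (fun e he => hPX (by simpa using he)) hX
    omega
  | succ k ih =>
    obtain ⟨e, heP, hev⟩ : v ∈ verts G P.edgeSet := by
      rw [verts_edgeSet hne]; exact P.end_mem_support
    have key : ∃ f ∈ X, f ∉ P.edges ∧ G.Inc f v := by
      obtain ⟨f, hfX, hfe, hfv⟩ := hXG e (hPX heP) v hev
      refine ⟨f, hfX, fun hf => hfe ?_, hfv⟩
      -- An edge of `P` at its end must be the last edge of `P`, hence equal to `e`; the other edge
      -- `f` at `v` is therefore new.
      have aux : ∀ g ∈ P.edges, G.Inc g v → P.reverse.edges.head? = some g := by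
        intro g hg hgv
        have hr := hP.reverse
        have hg' : g ∈ P.reverse.edges := by simpa using hg
        revert hr hg'
        generalize P.reverse = R
        intro hr hg'
        cases R with
        | nil => simp at hg'
        | cons e' h' R =>
          have := hr.notMem_edges_of_cons hgv
          simp only [edges_cons, List.mem_cons] at hg'
          simp only [edges_cons, List.head?_cons, Option.some.injEq]
          tauto
      have h1 := aux f hf hfv
      have h2 := aux e heP hev
      rw [h1] at h2
      simpa using h2
    obtain ⟨f, hfX, hfP, y, hfy⟩ := key
    by_cases hy : y ∈ S ∨ y ∈ P.support
    · exact ⟨v, P, f, y, hP, hPX, hne, hPS, hfX, hfP, hfy, hy⟩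
    · push Not at hy
      refine ih (P.append (single f hfy)) ?_ ?_ (by simp) ?_ (by simp; omega)
      · rw [isPath_append]
        refine ⟨hP, isPath_single ?_, ?_⟩
        · rintro rfl
          exact hy.2 P.end_mem_support
        · intro x hx hx'
          simp only [support_single, List.mem_cons, List.not_mem_nil, or_false] at hx'
          rcases hx' with rfl | rfl
          · rfl
          · exact absurd hx hy.2
      · intro g hg
        simp only [mem_edgeSet, edges_append, edges_single, List.mem_append,
          List.mem_singleton] at hg
        rcases hg with hg | rfl
        · exact hPX hg
        · exact hfX
      · intro x hx
        simp only [tailSupport_append, tailSupport_single, List.mem_append,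
          List.mem_singleton] at hx
        rcases hx with hx | rfl
        · exact hPS x hx
        · exact hy.1

/-! ### Integral chains of walks and the boundary map of a signed graph -/

section chains

variable {α β : Type*} (G : Graph α β) (s : β → ℤˣ)

open Classical in
/-- The column of the edge `e` in the incidence matrix of the signed graph `(G, s)`, with respect
to a chosen orientation of `e`. -/
noncomputable def incidence (e : β) : α →₀ ℚ :=
  if h : ∃ p : α × α, G.IsLink e p.1 p.2 then
    Finsupp.single h.choose.1 1 - ((s e : ℤ) : ℚ) • Finsupp.single h.choose.2 1
  else 0

open Classical in
/-- The factor relating the orientation `(u, v)` of the edge `e` to the chosen one. -/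
noncomputable def dir (e : β) (u v : α) : ℤˣ :=
  if ∃ h : ∃ p : α × α, G.IsLink e p.1 p.2, (u, v) = h.choose then 1 else -s e

/-- The boundary map of the signed graph `(G, s)`. -/
noncomputable def boundary : (β →₀ ℤ) →ₗ[ℤ] (α →₀ ℚ) :=
  Finsupp.linearCombination ℤ (incidence G s)

variable {G}

/-- The integral chain of a walk in the signed graph `(G, s)`. -/
noncomputable def chain : {u v : α} → Walk G u v → (β →₀ ℤ)
  | _, _, nil _ => 0
  | u, _, cons (v := v) e _ W => Finsupp.single e (dir G s e u v : ℤ) + (s e : ℤ) • chain W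

/-- The sign of a walk in the signed graph `(G, s)`. -/
def walkSign {u v : α} (W : Walk G u v) : ℤˣ :=
  (W.edges.map s).prod

variable {s} {u v w : α}

@[simp] lemma chain_nil (hv : v ∈ G.vertexSet) : chain s (nil hv) = 0 := by
  simp [chain]

@[simp] lemma chain_cons (e : β) (h : G.IsLink e u v) (W : Walk G v w) :
    chain s (cons e h W) = Finsupp.single e (dir G s e u v : ℤ) + (s e : ℤ) • chain s W := by
  simp [chain]

@[simp] lemma walkSign_nil (hv : v ∈ G.vertexSet) : walkSign s (nil hv) = 1 := by
  simp [walkSign]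

@[simp] lemma walkSign_cons (e : β) (h : G.IsLink e u v) (W : Walk G v w) :
    walkSign s (cons e h W) = s e * walkSign s W := by
  simp [walkSign]

@[simp] lemma walkSign_append (A : Walk G u v) (B : Walk G v w) :
    walkSign s (A.append B) = walkSign s A * walkSign s B := by
  simp [walkSign]

@[simp] lemma walkSign_single (e : β) (h : G.IsLink e u v) : walkSign s (single e h) = s e := by
  simp [walkSign]

lemma walkSign_eq_of_perm {u' v' : α} {W : Walk G u v} {W' : Walk G u' v'}
    (h : W.edges.Perm W'.edges) : walkSign s W = walkSign s W' :=
  (h.map s).prod_eq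

@[simp] lemma walkSign_reverse (W : Walk G u v) : walkSign s W.reverse = walkSign s W :=
  walkSign_eq_of_perm (by simp)

lemma walkSign_one (W : Walk G u v) : walkSign (fun _ => 1) W = 1 := by
  simp [walkSign]

lemma dir_smul_incidence {e : β} (h : G.IsLink e u v) :
    (dir G s e u v : ℤ) • incidence G s e =
      Finsupp.single u 1 - ((s e : ℤ) : ℚ) • Finsupp.single v 1 := by
  have hp : ∃ p : α × α, G.IsLink e p.1 p.2 := ⟨(u, v), h⟩
  rw [incidence, dir, dif_pos hp]
  by_cases huv : (u, v) = hp.choose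
  · rw [if_pos ⟨hp, huv⟩, ← huv]
    simp
  · rw [if_neg (by rintro ⟨_, h'⟩; exact huv h')]
    rcases h.eq_and_eq_or_eq_and_eq hp.choose_spec with ⟨h1, h2⟩ | ⟨h1, h2⟩
    · exact absurd (Prod.ext h1 h2) huv
    · rw [← h1, ← h2]
      rcases Int.units_eq_one_or (s e) with hs | hs <;> simp [hs, add_comm]

lemma incidence_of_not_inc {e : β} {x : α} (h : ¬ G.Inc e x) : incidence G s e x = 0 := by
  classical
  by_cases hp : ∃ p : α × α, G.IsLink e p.1 p.2
  · rw [incidence, dif_pos hp]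
    have h1 : hp.choose.1 ≠ x := fun hx => h ⟨_, hx ▸ hp.choose_spec⟩
    have h2 : hp.choose.2 ≠ x := fun hx => h ⟨_, hx ▸ hp.choose_spec.symm⟩
    simp [h1, h2]
  · simp [incidence, hp]

/-- A negative loop has entry ±2 at its vertex. The hypothesis excludes positive loops, whose column
is zero. -/
lemma incidence_ne_zero {e : β} (h : G.IsLink e u v) (hs : u = v → s e = -1) :
    incidence G s e u ≠ 0 := by
  intro h0
  have := DFunLike.congr_fun (dir_smul_incidence (s := s) h) u
  rw [Finsupp.smul_apply, h0, smul_zero] at this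
  by_cases huv : u = v
  · subst huv
    norm_num [hs rfl] at this
  · simp [Ne.symm huv] at this

lemma boundary_single (e : β) (n : ℤ) :
    boundary G s (Finsupp.single e n) = n • incidence G s e := by
  simp [boundary]

lemma boundary_apply (z : β →₀ ℤ) (x : α) :
    boundary G s z x = ∑ e ∈ z.support, (z e : ℚ) * incidence G s e x := by
  simp [boundary, Finsupp.linearCombination_apply, Finsupp.sum]

lemma boundary_apply_eq {z : β →₀ ℤ} {x : α} {e : β}
    (h : ∀ f, z f ≠ 0 → G.Inc f x → f = e) :
    boundary G s z x = z e * incidence G s e x := by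
  rw [boundary_apply]
  refine Finset.sum_eq_single e (fun f hf hfe => ?_) (fun he => ?_)
  · rw [incidence_of_not_inc fun hx => hfe (h f (by simpa using hf) hx), mul_zero]
  · simp [Finsupp.notMem_support_iff.1 he]

lemma boundary_apply_congr {z z' : β →₀ ℤ} {x : α} (h : ∀ f, G.Inc f x → z f = z' f) :
    boundary G s z x = boundary G s z' x := by
  rw [← sub_eq_zero, ← Finsupp.sub_apply, ← map_sub, boundary_apply]
  refine Finset.sum_eq_zero fun f _ => ?_
  by_cases hf : G.Inc f x
  · simp [h f hf]
  · simp [incidence_of_not_inc hf]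

lemma boundary_chain (W : Walk G u v) :
    boundary G s (chain s W) =
      Finsupp.single u 1 - ((walkSign s W : ℤ) : ℚ) • Finsupp.single v 1 := by
  induction W with
  | nil => simp
  | cons e h W ih =>
    rw [chain_cons, map_add, map_smul, ih, boundary_single, dir_smul_incidence h, walkSign_cons,
      ← Int.cast_smul_eq_zsmul ℚ, smul_sub, smul_smul]
    push_cast
    abel

lemma chain_apply_of_notMem {W : Walk G u v} {e : β} (he : e ∉ W.edges) : chain s W e = 0 := by
  induction W with
  | nil => simp
  | cons f h W ih =>
    simp only [edges_cons, List.mem_cons, not_or] at he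
    simp [ih he.2, Ne.symm he.1]

/-- Every traversal of `e` contributes 1 or -1, and signs are invisible modulo 2. This makes
traversal parities accessible to the boundary map. -/
lemma chain_apply_cast (W : Walk G u v) [DecidableEq β] (e : β) :
    ((chain s W e : ℤ) : ZMod 2) = W.edges.count e := by
  have hu : ∀ t : ℤˣ, (((t : ℤˣ) : ℤ) : ZMod 2) = 1 := by
    intro t
    rcases Int.units_eq_one_or t with rfl | rfl
    · rfl
    · rfl
  induction W with
  | nil => simp
  | cons f h W ih =>
    rw [chain_cons, Finsupp.add_apply, Finsupp.smul_apply, edges_cons, List.count_cons]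
    push_cast
    rw [smul_eq_mul, Int.cast_mul, ih, hu, one_mul, add_comm, Finsupp.single_apply]
    by_cases hfe : f = e
    · simp [hfe, hu]
    · simp [hfe]

lemma chain_apply_of_count_eq_one {W : Walk G u v} [DecidableEq β] {e : β}
    (he : W.edges.count e = 1) : chain s W e = 1 ∨ chain s W e = -1 := by
  induction W with
  | nil => simp at he
  | @cons u v _ f h W ih =>
    rw [edges_cons, List.count_cons] at he
    rw [chain_cons, Finsupp.add_apply, Finsupp.smul_apply, Finsupp.single_apply, smul_eq_mul]
    by_cases hfe : f = e
    · have h0 : chain s W e = 0 := by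
        refine chain_apply_of_notMem (List.count_eq_zero.1 ?_)
        simpa [hfe] using he
      rw [if_pos hfe, h0, mul_zero, add_zero]
      rcases Int.units_eq_one_or (dir G s f u v) with h | h <;> simp [h]
    · have h1 := ih (by simpa [hfe] using he)
      rw [if_neg hfe, zero_add]
      rcases Int.units_eq_one_or (s f) with h | h <;> rcases h1 with h1 | h1 <;> simp [h, h1]

lemma chain_apply_of_nodup {W : Walk G u v} (hW : W.edges.Nodup) {e : β} (he : e ∈ W.edges) :
    chain s W e = 1 ∨ chain s W e = -1 := by
  classical exact chain_apply_of_count_eq_one (List.count_eq_one_of_mem hW he)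

/-- The first edge is the only edge of the path at the first vertex, so the boundary there forces
its coefficient to vanish; then the path is shortened. -/
lemma eq_zero_of_boundary_path {W : Walk G u w} (hW : W.IsPath) {y : β →₀ ℤ}
    (hy : ∀ e, y e ≠ 0 → e ∈ W.edges)
    (hb : ∀ x ∈ W.support, x ≠ w → boundary G s y x = 0) : y = 0 := by
  induction W with
  | nil =>
    ext e
    by_contra he
    simpa using hy e he
  | @cons u v w e h W ih =>
    obtain ⟨hu, hW'⟩ := isPath_cons.1 hW
    have hye : y e = 0 := by
      have h1 := hb u (by simp) (fun huw => hu (huw ▸ W.end_mem_support))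
      rw [boundary_apply_eq (e := e)] at h1
      · have h2 := incidence_ne_zero (s := s) h (fun huv => absurd W.start_mem_support (huv ▸ hu))
        simpa [h2] using h1
      · intro f hf hfu
        have := hy f hf
        by_contra hfe
        exact hW.notMem_edges_of_cons hfu (by simpa [hfe] using this)
    refine ih hW' (fun f hf => ?_) (fun x hx => hb x (by simp [hx]))
    have := hy f hf
    simp only [edges_cons, List.mem_cons] at this
    rcases this with rfl | h
    · exact absurd hye hf
    · exact h

/-- The coefficient of the walk's chain at `e` is `dir G s e u v`, a sign, so `z e * dir G s e u v`
is the multiple that cancels `z` at `e`. The difference lives on the path `W` and vanishes. The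
disjunction `hu` covers both paths and simple closed walks. -/
lemma eq_smul_chain_cons {e : β} {h : G.IsLink e u v} {W : Walk G v w} (hW : W.IsPath)
    (he : e ∉ W.edges) (hu : u ∉ W.support ∨ u = w) {z : β →₀ ℤ}
    (hz : ∀ f, z f ≠ 0 → f ∈ (cons e h W).edges)
    (hb : ∀ x ∈ W.support, x ≠ w → boundary G s z x = 0) :
    ∃ c : ℤ, z = c • chain s (cons e h W) := by
  refine ⟨z e * dir G s e u v, ?_⟩
  rw [← sub_eq_zero]
  refine eq_zero_of_boundary_path (s := s) hW ?_ ?_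
  · intro f hf
    by_contra hfW
    apply hf
    by_cases hfe : f = e
    · subst hfe
      simp [chain_apply_of_notMem he, mul_assoc]
    · have h1 : z f = 0 := by
        by_contra h0
        have := hz f h0
        simp [hfe, hfW] at this
      simp [h1, chain_apply_of_notMem hfW, Ne.symm hfe]
  · intro x hx hxw
    have hxu : u ≠ x := by
      rintro rfl
      rcases hu with hu | rfl
      · exact hu hx
      · exact hxw rfl
    rw [map_sub, map_smul, boundary_chain, Finsupp.sub_apply, hb x hx hxw]
    simp [hxu, Ne.symm hxw]

lemma eq_smul_chain_of_isPath {W : Walk G u w} (hW : W.IsPath) {z : β →₀ ℤ}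
    (hz : ∀ f, z f ≠ 0 → f ∈ W.edges)
    (hb : ∀ x ∈ W.support, x ≠ u → x ≠ w → boundary G s z x = 0) :
    ∃ c : ℤ, z = c • chain s W := by
  cases W with
  | nil =>
    refine ⟨0, ?_⟩
    ext e
    by_contra he
    have h0 : z e ≠ 0 := by simpa using he
    simpa using hz e h0
  | cons e h W =>
    obtain ⟨hu, hW'⟩ := isPath_cons.1 hW
    refine eq_smul_chain_cons hW' (hW.notMem_edges_of_cons h.inc_left) (Or.inl hu) hz ?_
    intro x hx hxw
    exact hb x (by simp [hx]) (by rintro rfl; exact hu hx) hxw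

lemma eq_smul_chain_of_isSimpleClosed {W : Walk G u u} (hW : W.IsSimpleClosed) {z : β →₀ ℤ}
    (hz : ∀ f, z f ≠ 0 → f ∈ W.edges)
    (hb : ∀ x ∈ W.support, x ≠ u → boundary G s z x = 0) :
    ∃ c : ℤ, z = c • chain s W := by
  cases W with
  | nil => exact absurd rfl hW.1
  | cons e h W =>
    obtain ⟨hW', he⟩ := isSimpleClosed_cons.1 hW
    exact eq_smul_chain_cons hW' he (Or.inr rfl) hz fun x hx hxw => hb x (by simp [hx]) hxw

end chains

/-! ### Handcuffs and their circuit vectors -/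

section handcuffs

variable {α β : Type*} {G : Graph α β} {s : β → ℤˣ}

/-- `C` is a handcuff, described by simple closed walks around its cycles and by a path that
connects the base vertices of these walks, of length zero if the handcuff is tight. -/
structure IsHandcuffOf (C : Set β) {u v : α} (W₁ : Walk G u u) (P : Walk G u v)
    (W₂ : Walk G v v) : Prop where
  left : W₁.IsSimpleClosed
  right : W₂.IsSimpleClosed
  path : P.IsPath
  eq_union : C = W₁.edgeSet ∪ P.edgeSet ∪ W₂.edgeSet
  path_left : ∀ x ∈ P.support, x ∈ W₁.support → x = u
  path_right : ∀ x ∈ P.support, x ∈ W₂.support → x = v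
  left_right : ∀ x ∈ W₁.support, x ∈ W₂.support → x = u ∧ x = v
  disjoint : ∀ e ∈ W₁.edges, e ∉ W₂.edges

lemma IsHandcuff.exists_isHandcuffOf {C : Set β} (hC : IsHandcuff G C) :
    ∃ (u v : α) (W₁ : Walk G u u) (P : Walk G u v) (W₂ : Walk G v v),
      IsHandcuffOf C W₁ P W₂ := by
  rcases hC with ⟨C₁, C₂, h₁, h₂, hd, ⟨v, hv⟩, rfl⟩ | ⟨C₁, C₂, h₁, h₂, hd, u, v, P, hP, hu, hv, rfl⟩
  · have hv' : v ∈ verts G C₁ ∩ verts G C₂ := by simp [hv]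
    obtain ⟨W₁, hW₁, rfl⟩ := h₁.exists_walk hv'.1
    obtain ⟨W₂, hW₂, rfl⟩ := h₂.exists_walk hv'.2
    have hvG : v ∈ G.vertexSet := by
      obtain ⟨e, -, he⟩ := hv'.1
      exact he.vertex_mem
    rw [hW₁.verts, hW₂.verts] at hv
    refine ⟨v, v, W₁, .nil hvG, W₂, hW₁, hW₂, by simp [IsPath], ?_, by simp, by simp, ?_, ?_⟩
    · ext e
      simp
    · intro x hx₁ hx₂
      have : x ∈ ({v} : Set α) := hv ▸ ⟨hx₁, hx₂⟩
      exact ⟨this, this⟩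
    · exact fun e he₁ he₂ => Set.disjoint_left.1 hd he₁ he₂
  · have hu' : u ∈ verts G C₁ := (hu.symm ▸ rfl : u ∈ {x | x ∈ P.support} ∩ verts G C₁).2
    have hv' : v ∈ verts G C₂ := (hv.symm ▸ rfl : v ∈ {x | x ∈ P.support} ∩ verts G C₂).2
    obtain ⟨W₁, hW₁, rfl⟩ := h₁.exists_walk hu'
    obtain ⟨W₂, hW₂, rfl⟩ := h₂.exists_walk hv'
    rw [hW₁.verts] at hu hd
    rw [hW₂.verts] at hv hd
    refine ⟨u, v, W₁, P, W₂, hW₁, hW₂, hP, ?_, ?_, ?_, ?_, ?_⟩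
    · ext e
      simp only [Set.mem_union, mem_edgeSet]
      tauto
    · exact fun x hx hx₁ => (hu ▸ ⟨hx, hx₁⟩ : x ∈ ({u} : Set α))
    · exact fun x hx hx₁ => (hv ▸ ⟨hx, hx₁⟩ : x ∈ ({v} : Set α))
    · exact fun x hx₁ hx₂ => (Set.disjoint_left.1 hd hx₁ hx₂).elim
    · intro e he₁ he₂
      obtain ⟨a, b, hs⟩ := exists_step he₁
      have hab := (of_mem_steps hs).1
      exact Set.disjoint_left.1 hd (mem_support_of_isLink he₁ hab) (mem_support_of_isLink he₂ hab)

lemma Walk.IsPath.ne_of_isLink {u v a b : α} {P : Walk G u v} (hP : P.IsPath) {e : β}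
    (he : e ∈ P.edges) (hab : G.IsLink e a b) : a ≠ b := by
  rintro rfl
  induction P with
  | nil => simp at he
  | cons f hf P ih =>
    simp only [edges_cons, List.mem_cons] at he
    rcases he with rfl | he
    · rcases hab.eq_and_eq_or_eq_and_eq hf with ⟨rfl, h2⟩ | ⟨rfl, h2⟩
      · exact (isPath_cons.1 hP).1 (h2 ▸ P.start_mem_support)
      · exact (isPath_cons.1 hP).1 (h2 ▸ P.start_mem_support)
    · exact ih (isPath_cons.1 hP).2 he

namespace IsHandcuffOf

variable {C : Set β} {u v : α} {W₁ : Walk G u u} {P : Walk G u v} {W₂ : Walk G v v}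

lemma edges_path_of_eq (h : IsHandcuffOf C W₁ P W₂) (huv : u = v) : P.edges = [] := by
  subst huv
  cases P with
  | nil => simp
  | cons e he P => exact absurd P.end_mem_support (isPath_cons.1 h.path).1

lemma isHandcuff (h : IsHandcuffOf C W₁ P W₂) : IsHandcuff G C := by
  by_cases huv : u = v
  · subst huv
    have hP : P.edgeSet = ∅ := by simp [Walk.edgeSet, h.edges_path_of_eq rfl]
    refine Or.inl ⟨_, _, ⟨u, W₁, h.left, rfl⟩, ⟨u, W₂, h.right, rfl⟩,
      Set.disjoint_left.2 h.disjoint, ⟨u, ?_⟩, by simp [h.eq_union, hP]⟩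
    rw [h.left.verts, h.right.verts]
    ext x
    refine ⟨fun hx => (h.left_right x hx.1 hx.2).1, ?_⟩
    rintro rfl
    exact ⟨W₁.start_mem_support, W₂.start_mem_support⟩
  · refine Or.inr ⟨_, _, ⟨u, W₁, h.left, rfl⟩, ⟨v, W₂, h.right, rfl⟩, ?_, u, v, P, h.path, ?_, ?_,
      ?_⟩
    · rw [h.left.verts, h.right.verts, Set.disjoint_left]
      intro x hx hx'
      obtain ⟨h1, h2⟩ := h.left_right x hx hx'
      exact huv (h1.symm.trans h2)
    · rw [h.left.verts]
      ext x
      refine ⟨fun hx => h.path_left x hx.1 hx.2, ?_⟩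
      rintro rfl
      exact ⟨P.start_mem_support, W₁.start_mem_support⟩
    · rw [h.right.verts]
      ext x
      refine ⟨fun hx => h.path_right x hx.1 hx.2, ?_⟩
      rintro rfl
      exact ⟨P.end_mem_support, W₂.start_mem_support⟩
    · rw [h.eq_union, Set.union_right_comm]

lemma notMem_of_mem_path (h : IsHandcuffOf C W₁ P W₂) {e : β} (he : e ∈ P.edges) :
    e ∉ W₁.edges ∧ e ∉ W₂.edges := by
  obtain ⟨a, b, hab⟩ : ∃ a b, G.IsLink e a b := by
    obtain ⟨a, b, hs⟩ := exists_step he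
    exact ⟨a, b, (of_mem_steps hs).1⟩
  have hne : a ≠ b := h.path.ne_of_isLink he hab
  have ha := mem_support_of_isLink he hab
  have hb := mem_support_of_isLink he hab.symm
  constructor
  · intro he'
    exact hne ((h.path_left a ha (mem_support_of_isLink he' hab)).trans
      (h.path_left b hb (mem_support_of_isLink he' hab.symm)).symm)
  · intro he'
    exact hne ((h.path_right a ha (mem_support_of_isLink he' hab)).trans
      (h.path_right b hb (mem_support_of_isLink he' hab.symm)).symm)

lemma chain_path_of_eq (h : IsHandcuffOf C W₁ P W₂) (huv : u = v) : chain s P = 0 := by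
  ext e
  exact chain_apply_of_notMem (by simp [h.edges_path_of_eq huv])

/-- Restrict `z` to the two cycles and to the path. A vertex of one piece other than its attachment
vertices meets no other piece, so the restriction has zero boundary there and is a multiple of the
chain of its piece. -/
lemma exists_eq_chains (h : IsHandcuffOf C W₁ P W₂) {z : β →₀ ℤ}
    (hz : ∀ e, z e ≠ 0 → e ∈ C) (hb : boundary G s z = 0) :
    ∃ a b c : ℤ, z = a • chain s W₁ + b • chain s P + c • chain s W₂ := by
  classical
  have hC : ∀ e, z e ≠ 0 → e ∈ W₁.edges ∨ e ∈ P.edges ∨ e ∈ W₂.edges := by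
    intro e he
    have := hz e he
    rw [h.eq_union] at this
    simp only [Set.mem_union, mem_edgeSet] at this
    tauto
  have hb' : ∀ x, boundary G s z x = 0 := fun x => by rw [hb]; rfl
  have hinc : ∀ {a b : α} {W : Walk G a b} {f : β} {x : α}, G.Inc f x → f ∈ W.edges →
      x ∈ W.support := fun ⟨y, hy⟩ hf => mem_support_of_isLink hf hy
  obtain ⟨a, ha⟩ := eq_smul_chain_of_isSimpleClosed (s := s) h.left
    (z := z.filter (· ∈ W₁.edges)) (fun f hf => by
      by_contra hf'
      simp [hf'] at hf) (fun x hx hxu => by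
      rw [← hb' x]
      refine boundary_apply_congr fun f hf => ?_
      by_cases hf₁ : f ∈ W₁.edges
      · simp [hf₁]
      · by_contra hne
        rcases hC f (by simpa [hf₁, eq_comm] using hne) with hf' | hf' | hf'
        · exact hf₁ hf'
        · exact hxu (h.path_left x (hinc hf hf') hx)
        · exact hxu (h.left_right x hx (hinc hf hf')).1)
  obtain ⟨b, hb⟩ := eq_smul_chain_of_isPath (s := s) h.path
    (z := z.filter (· ∈ P.edges)) (fun f hf => by
      by_contra hf'
      simp [hf'] at hf) (fun x hx hxu hxv => by
      rw [← hb' x]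
      refine boundary_apply_congr fun f hf => ?_
      by_cases hf₁ : f ∈ P.edges
      · simp [hf₁]
      · by_contra hne
        rcases hC f (by simpa [hf₁, eq_comm] using hne) with hf' | hf' | hf'
        · exact hxu (h.path_left x hx (hinc hf hf'))
        · exact hf₁ hf'
        · exact hxv (h.path_right x hx (hinc hf hf')))
  obtain ⟨c, hc⟩ := eq_smul_chain_of_isSimpleClosed (s := s) h.right
    (z := z.filter (· ∈ W₂.edges)) (fun f hf => by
      by_contra hf'
      simp [hf'] at hf) (fun x hx hxv => by
      rw [← hb' x]
      refine boundary_apply_congr fun f hf => ?_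
      by_cases hf₁ : f ∈ W₂.edges
      · simp [hf₁]
      · by_contra hne
        rcases hC f (by simpa [hf₁, eq_comm] using hne) with hf' | hf' | hf'
        · exact hxv (h.left_right x (hinc hf hf') hx).2
        · exact hxv (h.path_right x (hinc hf hf') hx)
        · exact hf₁ hf')
  refine ⟨a, b, c, ?_⟩
  rw [← ha, ← hb, ← hc]
  ext e
  simp only [Finsupp.add_apply, Finsupp.filter_apply]
  have h1 := fun he => h.notMem_of_mem_path (e := e) he
  have h2 := h.disjoint e
  have h3 := hC e
  by_cases hz0 : z e = 0
  · simp [hz0]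
  · rcases h3 hz0 with he | he | he
    · have : e ∉ P.edges := fun hp => (h1 hp).1 he
      simp [he, h2 he, this]
    · simp [he, h1 he]
    · have h4 : e ∉ P.edges := fun hp => (h1 hp).2 he
      have h5 : e ∉ W₁.edges := fun hp => h2 hp he
      simp [he, h4, h5]

/-- A chain on a handcuff that is a cycle in the unsigned sense vanishes on the path. -/
lemma apply_eq_zero_of_unsigned (h : IsHandcuffOf C W₁ P W₂) {z : β →₀ ℤ}
    (hz : ∀ e, z e ≠ 0 → e ∈ C) (hb : boundary G (fun _ => 1) z = 0) {e : β} (he : e ∈ P.edges) :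
    z e = 0 := by
  have huv : u ≠ v := by
    intro huv
    simp [h.edges_path_of_eq huv] at he
  obtain ⟨a, b, c, rfl⟩ := h.exists_eq_chains hz hb
  -- With all signs 1 the closed walks have boundary zero, so the boundary at `u` is just the
  -- coefficient `b` of the path.
  have h0 := DFunLike.congr_fun hb u
  simp only [map_add, map_smul, boundary_chain, walkSign_one] at h0
  simp [huv.symm] at h0
  obtain ⟨h1, h2⟩ := h.notMem_of_mem_path he
  simp [h0, chain_apply_of_notMem h1, chain_apply_of_notMem h2]

variable (s W₁ P W₂) in
/-- The fundamental cycle of a handcuff with negative cycles. -/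
noncomputable def vector : β →₀ ℤ :=
  chain s W₁ - (2 : ℤ) • chain s P - (walkSign s P : ℤ) • chain s W₂

/-- A negative closed walk at `u` has boundary `2u`, and the path has boundary `u - σ(P) v`. Hence
the coefficients 1, -2 and `-σ(P)` balance at both ends. -/
lemma boundary_vector (h₁ : walkSign s W₁ = -1)
    (h₂ : walkSign s W₂ = -1) : boundary G s (vector s W₁ P W₂) = 0 := by
  simp only [vector, map_sub, map_smul, boundary_chain, h₁, h₂]
  ext x
  simp
  ring

lemma vector_apply (h : IsHandcuffOf C W₁ P W₂) (e : β) :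
    (e ∈ C → vector s W₁ P W₂ e ≠ 0 ∧ vector s W₁ P W₂ e ∣ 2) ∧ (e ∉ C → vector s W₁ P W₂ e = 0) := by
  have h1 := fun he => h.notMem_of_mem_path (e := e) he
  have h2 := h.disjoint e
  rw [h.eq_union]
  simp only [Set.mem_union, mem_edgeSet, vector, Finsupp.sub_apply, Finsupp.smul_apply,
    smul_eq_mul]
  constructor
  · rintro ((he | he) | he)
    · have : e ∉ P.edges := fun hp => (h1 hp).1 he
      rw [chain_apply_of_notMem this, chain_apply_of_notMem (h2 he)]
      rcases chain_apply_of_nodup (s := s) h.left.2.1 he with h | h <;> rw [h] <;> simp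
    · rw [chain_apply_of_notMem (h1 he).1, chain_apply_of_notMem (h1 he).2]
      rcases chain_apply_of_nodup (s := s) h.path.edges_nodup he with h | h <;> rw [h] <;> simp
    · have h4 : e ∉ P.edges := fun hp => (h1 hp).2 he
      have h5 : e ∉ W₁.edges := fun hp => h2 hp he
      rw [chain_apply_of_notMem h4, chain_apply_of_notMem h5]
      rcases Int.units_eq_one_or (walkSign s P) with hs | hs <;>
      rcases chain_apply_of_nodup (s := s) h.right.2.1 he with h | h <;> rw [h, hs] <;> simp
  · intro he
    simp only [not_or] at he
    simp [chain_apply_of_notMem he.1.1, chain_apply_of_notMem he.1.2, chain_apply_of_notMem he.2]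

/-- For `u ≠ v` the boundary at `u` gives `2a + b = 0`, and at `v` it gives `2c = σ(P) b`, so `a`
determines `b` and `c`. For `u = v` the path has zero chain, and `2a + 2c = 0`. -/
lemma eq_smul_vector (h : IsHandcuffOf C W₁ P W₂) (h₁ : walkSign s W₁ = -1)
    (h₂ : walkSign s W₂ = -1) {z : β →₀ ℤ} (hz : ∀ e, z e ≠ 0 → e ∈ C)
    (hb : boundary G s z = 0) : ∃ c : ℤ, z = c • vector s W₁ P W₂ := by
  obtain ⟨a, b, c, rfl⟩ := h.exists_eq_chains hz hb
  refine ⟨a, ?_⟩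
  simp only [map_add, map_smul, boundary_chain, h₁, h₂] at hb
  by_cases huv : u = v
  · have hs : walkSign s P = 1 := by simp [walkSign, h.edges_path_of_eq huv]
    have h0 := DFunLike.congr_fun hb u
    simp [← huv, hs] at h0
    have hc : c = -a := by
      have : (c : ℚ) = -a := by linarith
      exact_mod_cast this
    simp only [vector, h.chain_path_of_eq huv, hs, hc, Units.val_one]
    module
  · have h0 := DFunLike.congr_fun hb u
    have h3 := DFunLike.congr_fun hb v
    simp [huv, Ne.symm huv] at h0 h3
    have hb' : b = -2 * a := by
      have : (b : ℚ) = -2 * a := by linarith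
      exact_mod_cast this
    have hc : c = -(walkSign s P : ℤ) * a := by
      rcases Int.units_eq_one_or (walkSign s P) with hs | hs
      · simp only [hs] at h3 ⊢
        have : (c : ℚ) = -a := by push_cast at h3; rw [hb'] at h3; push_cast at h3; linarith
        have : c = -a := by exact_mod_cast this
        simpa using this
      · simp only [hs] at h3 ⊢
        have : (c : ℚ) = a := by push_cast at h3; rw [hb'] at h3; push_cast at h3; linarith
        have : c = a := by exact_mod_cast this
        simpa using this
    rw [vector, hb', hc, smul_sub, smul_sub, smul_smul, smul_smul, sub_eq_add_neg, sub_eq_add_neg,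
      ← neg_smul, ← neg_smul]
    congr 2
    · congr 2; ring
    · ring

end IsHandcuffOf

end handcuffs

/-! ### Circuits of the frame matroid of a signed graph as minimal supports of kernel vectors -/

section signedCircuits

variable {α β : Type*} {G : Graph α β} {s : β → ℤˣ}

variable (G s) in
/-- `C` is a cycle of sign `1`. -/
def IsPositiveCycle (C : Set β) : Prop :=
  ∃ (v : α) (W : Walk G v v), W.IsSimpleClosed ∧ W.edgeSet = C ∧ walkSign s W = 1

variable (G s) in
/-- The circuits of the frame matroid of the signed graph `(G, s)`. -/
def IsSignedCircuit (C : Set β) : Prop :=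
  IsPositiveCycle G s C ∨
    ((IsHandcuff G C ∨ IsTheta G C) ∧ ∀ D ⊆ C, IsCycle G D → ¬ IsPositiveCycle G s D)

lemma IsPositiveCycle.isCycle {C : Set β} (h : IsPositiveCycle G s C) : IsCycle G C := by
  obtain ⟨v, W, hW, hC, -⟩ := h
  exact ⟨v, W, hW, hC⟩

lemma walkSign_eq_neg_one {C : Set β} (h : ∀ D ⊆ C, IsCycle G D → ¬ IsPositiveCycle G s D) {v : α}
    {W : Walk G v v} (hW : W.IsSimpleClosed) (hWC : W.edgeSet ⊆ C) : walkSign s W = -1 := by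
  rcases Int.units_eq_one_or (walkSign s W) with h1 | h1
  · exact absurd ⟨v, W, hW, rfl, h1⟩ (h _ hWC ⟨v, W, hW, rfl⟩)
  · exact h1

/-- Two internally disjoint paths of equal sign form a positive cycle. -/
lemma isPositiveCycle_of_paths {a b : α} {P Q : Walk G a b} (hab : a ≠ b) (hP : P.IsPath)
    (hQ : Q.IsPath) (he : Disjoint P.edgeSet Q.edgeSet)
    (hs : ∀ x ∈ P.support, x ∈ Q.support → x = a ∨ x = b) (h : walkSign s P = walkSign s Q) :
    IsPositiveCycle G s (P.edgeSet ∪ Q.edgeSet) := by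
  have hQe : Q.reverse.edgeSet = Q.edgeSet := by ext; simp
  refine ⟨a, P.append Q.reverse, ?_, ?_, by simp [h, Int.units_mul_self]⟩
  · exact isSimpleClosed_append hab hP hQ.reverse (hQe ▸ he) (by simpa using hs)
  · ext e
    simp

/-- Two of the three paths have the same sign, by the pigeonhole principle. -/
lemma exists_positive_of_isTheta {C : Set β} (hC : IsTheta G C) :
    ∃ D ⊆ C, IsPositiveCycle G s D := by
  obtain ⟨u, v, P, huv, hP, hd, rfl⟩ := hC
  obtain ⟨i, j, hij, h⟩ : ∃ i j, i ≠ j ∧ walkSign s (P i) = walkSign s (P j) :=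
    Fintype.exists_ne_map_eq_of_card_lt (fun i => walkSign s (P i)) (by decide)
  refine ⟨_, Set.union_subset (Set.subset_iUnion (fun i => (P i).edgeSet) i)
    (Set.subset_iUnion (fun i => (P i).edgeSet) j), isPositiveCycle_of_paths huv (hP i) (hP j)
    (hd i j hij).1 (fun x hx hx' => ?_) h⟩
  have : x ∈ ({u, v} : Set α) := (hd i j hij).2 ▸ ⟨hx, hx'⟩
  simpa using this

/-- A cycle and a path between two of its vertices that is otherwise disjoint from the cycle contain
a positive cycle. -/
lemma exists_positive_of_ear {C : Set β} (hC : IsCycle G C) {a b : α} (hab : a ≠ b)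
    (ha : a ∈ verts G C) (hb : b ∈ verts G C) {Q : Walk G a b} (hQ : Q.IsPath)
    (hQC : Disjoint Q.edgeSet C) (hs : ∀ x ∈ Q.support, x ∈ verts G C → x = a ∨ x = b) :
    ∃ D ⊆ C ∪ Q.edgeSet, IsPositiveCycle G s D := by
  obtain ⟨W, hW, rfl⟩ := hC.exists_walk ha
  rw [hW.verts] at hs hb
  obtain ⟨A, B, rfl⟩ := exists_append_of_mem_support hb
  obtain ⟨hA, hB⟩ := hW.append_paths hab
  have hAe : A.edgeSet ⊆ (A.append B).edgeSet := fun e he => by simp_all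
  have hBe : B.reverse.edgeSet ⊆ (A.append B).edgeSet := fun e he => by simp_all
  by_cases h1 : walkSign s Q = walkSign s A
  · refine ⟨_, ?_, isPositiveCycle_of_paths hab hQ hA (hQC.mono_right hAe) ?_ h1⟩
    · exact Set.union_subset Set.subset_union_right (hAe.trans Set.subset_union_left)
    · intro x hx hx'
      refine hs x hx ?_
      simp [support_append, hx']
  by_cases h2 : walkSign s Q = walkSign s B
  · refine ⟨_, ?_, isPositiveCycle_of_paths hab hQ hB.reverse (hQC.mono_right hBe) ?_
      (by simpa using h2)⟩
    · exact Set.union_subset Set.subset_union_right (hBe.trans Set.subset_union_left)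
    · intro x hx hx'
      refine hs x hx ?_
      rw [support_reverse, List.mem_reverse] at hx'
      by_cases hxb : x = b
      · subst hxb
        simp [support_append, A.end_mem_support]
      · simp [support_append, mem_tailSupport_of_ne hx' hxb]
  -- The arcs `A` and `B` now both have the sign opposite to that of `Q`, so the original cycle is
  -- positive.
  · refine ⟨_, Set.subset_union_left, a, A.append B, hW, rfl, ?_⟩
    rw [walkSign_append]
    rcases Int.units_eq_one_or (walkSign s Q) with h | h <;>
    rcases Int.units_eq_one_or (walkSign s A) with h' | h' <;>
    rcases Int.units_eq_one_or (walkSign s B) with h'' | h'' <;> simp_all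

/-- Theta graphs drop out, since they always contain a positive cycle. -/
lemma IsSignedCircuit.cases {C : Set β} (hC : IsSignedCircuit G s C) :
    IsPositiveCycle G s C ∨
      ∃ (u v : α) (W₁ : Walk G u u) (P : Walk G u v) (W₂ : Walk G v v),
        IsHandcuffOf C W₁ P W₂ ∧ walkSign s W₁ = -1 ∧ walkSign s W₂ = -1 := by
  rcases hC with hC | ⟨hC | hC, hneg⟩
  · exact Or.inl hC
  · obtain ⟨u, v, W₁, P, W₂, h⟩ := hC.exists_isHandcuffOf
    refine Or.inr ⟨u, v, W₁, P, W₂, h, walkSign_eq_neg_one hneg h.left ?_,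
      walkSign_eq_neg_one hneg h.right ?_⟩
    · rw [h.eq_union, Set.union_assoc]
      exact Set.subset_union_left
    · rw [h.eq_union]
      exact Set.subset_union_right
  · obtain ⟨D, hD, hpos⟩ := exists_positive_of_isTheta (s := s) hC
    exact absurd hpos (hneg D hD hpos.isCycle)

lemma IsSignedCircuit.exists_isCycle {C : Set β} (hC : IsSignedCircuit G s C) :
    ∃ D ⊆ C, IsCycle G D := by
  rcases hC.cases with h | ⟨u, v, W₁, P, W₂, h, -⟩
  · exact ⟨C, subset_rfl, h.isCycle⟩
  · refine ⟨W₁.edgeSet, ?_, u, W₁, h.left, rfl⟩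
    rw [h.eq_union, Set.union_assoc]
    exact Set.subset_union_left

lemma IsSignedCircuit.nonempty {C : Set β} (hC : IsSignedCircuit G s C) : C.Nonempty := by
  obtain ⟨D, hDC, hD⟩ := hC.exists_isCycle
  exact hD.nonempty.mono hDC

lemma IsSignedCircuit.subset_edgeSet {C : Set β} (hC : IsSignedCircuit G s C) :
    C ⊆ G.edgeSet := by
  rcases hC.cases with h | ⟨u, v, W₁, P, W₂, h, -⟩
  · exact h.isCycle.subset_edgeSet
  · rw [h.eq_union]
    exact Set.union_subset (Set.union_subset W₁.edgeSet_subset P.edgeSet_subset) W₂.edgeSet_subset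

/-- A circuit supports an integral vector in the kernel of the boundary map whose entries divide
two, and every other such vector is a multiple of it. -/
lemma IsSignedCircuit.exists_vector {C : Set β} (hC : IsSignedCircuit G s C) :
    ∃ z : β →₀ ℤ, boundary G s z = 0 ∧ (∀ e, z e ≠ 0 ↔ e ∈ C) ∧ (∀ e ∈ C, z e ∣ 2) ∧
      ∀ y : β →₀ ℤ, boundary G s y = 0 → (∀ e, y e ≠ 0 → e ∈ C) → ∃ c : ℤ, y = c • z := by
  rcases hC.cases with ⟨v, W, hW, rfl, h1⟩ | ⟨u, v, W₁, P, W₂, h, h₁, h₂⟩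
  · refine ⟨chain s W, by simp [boundary_chain, h1], fun e => ⟨fun he => ?_, fun he => ?_⟩,
      fun e he => ?_, fun y hy hyC => ?_⟩
    · by_contra he'
      exact he (chain_apply_of_notMem he')
    · rcases chain_apply_of_nodup (s := s) hW.2.1 he with h | h <;> simp [h]
    · rcases chain_apply_of_nodup (s := s) hW.2.1 he with h | h <;> simp [h]
    · exact eq_smul_chain_of_isSimpleClosed hW hyC fun x _ _ => by simp [hy]
  · refine ⟨IsHandcuffOf.vector s W₁ P W₂, IsHandcuffOf.boundary_vector h₁ h₂,
      fun e => ⟨fun he => ?_, fun he => ((h.vector_apply e).1 he).1⟩,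
      fun e he => ((h.vector_apply e).1 he).2, fun y hy hyC => h.eq_smul_vector h₁ h₂ hyC hy⟩
    by_contra he'
    exact he ((h.vector_apply e).2 he')

/-- The vector of `D` is a nonzero multiple of the vector of `C`, so both have the same support. -/
lemma IsSignedCircuit.eq_of_subset {C D : Set β} (hC : IsSignedCircuit G s C)
    (hD : IsSignedCircuit G s D) (h : D ⊆ C) : D = C := by
  obtain ⟨z, -, hz, -, hzu⟩ := hC.exists_vector
  obtain ⟨y, hy, hyD, -⟩ := hD.exists_vector
  obtain ⟨c, hc⟩ := hzu y hy fun e he => h ((hyD e).1 he)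
  refine h.antisymm fun e he => ?_
  obtain ⟨f, hf⟩ := hD.nonempty
  have hc0 : c ≠ 0 := by
    rintro rfl
    exact (hyD f).2 hf (by simp [hc])
  rw [← hyD, hc]
  simpa [hc0] using (hz e).2 he

/-- The support of a nonzero vector in the kernel of the boundary map contains a circuit. -/
lemma exists_isSignedCircuit_of_boundary_eq_zero {z : β →₀ ℤ} (hz0 : z ≠ 0)
    (hz : boundary G s z = 0) (hzG : ∀ e, z e ≠ 0 → e ∈ G.edgeSet) :
    ∃ C, IsSignedCircuit G s C ∧ ∀ e ∈ C, z e ≠ 0 := by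
  classical
  set X : Set β := {e | z e ≠ 0} with hX
  have hXfin : X.Finite := by
    exact z.support.finite_toSet.subset fun e he => Finsupp.mem_support_iff.2 he
  by_contra! hcon
  have hpos : ∀ D ⊆ X, ¬ IsPositiveCycle G s D := fun D hD hp => by
    obtain ⟨e, he, he'⟩ := hcon D (Or.inl hp)
    exact hD he he'
  have hhand : ∀ {D : Set β} {u v : α} {W₁ : Walk G u u} {P : Walk G u v} {W₂ : Walk G v v},
      D ⊆ X → IsHandcuffOf D W₁ P W₂ → False := fun {D} u v W₁ P W₂ hD h => by
    obtain ⟨e, he, he'⟩ := hcon D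
      (Or.inr ⟨Or.inl h.isHandcuff, fun D' hD' _ => hpos D' (hD'.trans hD)⟩)
    exact hD he he'
  have hloop : ∀ e ∈ X, ∀ v, G.IsLink e v v → s e = -1 := by
    intro e he v h
    rcases Int.units_eq_one_or (s e) with h1 | h1
    · refine (hpos {e} (Set.singleton_subset_iff.2 he) ⟨v, single e h, ?_, ?_, by simpa using h1⟩).elim
      · exact ⟨by simp, by simp, by simp⟩
      · ext f; simp
    · exact h1
  -- If `e` were the only edge of the support at `v`, the boundary at `v` would be a nonzero
  -- multiple of `z e`; for loops this uses that they are negative.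
  have hdeg : ∀ e ∈ X, ∀ v, G.Inc e v → ∃ f ∈ X, f ≠ e ∧ G.Inc f v := by
    rintro e he v ⟨w, hvw⟩
    by_contra! h
    have h1 := boundary_apply_eq (G := G) (s := s) (z := z) (x := v) (e := e)
      fun f hf hfv => by_contra fun hfe => h f hf hfe hfv
    rw [hz] at h1
    have h2 := incidence_ne_zero (s := s) hvw fun hvw' => hloop e he v (hvw' ▸ hvw)
    have h3 : (z e : ℚ) ≠ 0 := by exact_mod_cast he
    simp [h2, h3] at h1
  -- An edge from the end of a path back to the path closes a cycle.
  have hclose : ∀ {a t y : α} {Q : Walk G a t} {f : β}, Q.IsPath → f ∉ Q.edges →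
      G.IsLink f t y → y ∈ Q.support → ∃ (A : Walk G a y) (B : Walk G y t) (W : Walk G y y),
        Q = A.append B ∧ W.IsSimpleClosed ∧ W.edgeSet = B.edgeSet ∪ {f} ∧
        (∀ x, x ∈ W.support ↔ x ∈ B.support) := by
    intro a t y Q f hQ hf h hy
    obtain ⟨A, B, rfl⟩ := exists_append_of_mem_support hy
    refine ⟨A, B, cons f h.symm B.reverse, rfl, ?_, ?_, ?_⟩
    · rw [isSimpleClosed_cons]
      refine ⟨(isPath_append.1 hQ).2.1.reverse, ?_⟩
      simp only [edges_append, List.mem_append, not_or] at hf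
      simpa using hf.2
    · ext e
      simp
    · intro x
      simp only [support_cons, support_reverse, List.mem_cons, List.mem_reverse]
      exact ⟨by rintro (rfl | h); exacts [B.start_mem_support, h], Or.inr⟩
  obtain ⟨C, hC, hCX⟩ : ∃ C, IsCycle G C ∧ C ⊆ X := by
    obtain ⟨e, he⟩ : ∃ e, e ∈ X := by
      by_contra! h
      refine hz0 (Finsupp.ext fun e => ?_)
      simpa [hX] using h e
    obtain ⟨a, b, hab⟩ := G.exists_isLink_of_mem_edgeSet (hzG e he)
    by_cases hne : a = b
    · subst hne
      refine ⟨{e}, ⟨a, single e hab, ⟨by simp, by simp, by simp⟩, ?_⟩,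
        Set.singleton_subset_iff.2 he⟩
      ext f
      simp
    · obtain ⟨t, Q, f, y, hQ, hQX, -, -, hfX, hf, hfty, hy⟩ :=
        exists_maximal_path hXfin hdeg ∅ (single e hab) (isPath_single hne)
          (by intro g hg; simp at hg; exact hg ▸ he) (by simp) (by simp)
      obtain ⟨A, B, W, rfl, hW, hWe, -⟩ := hclose hQ hf hfty (by simpa using hy)
      refine ⟨W.edgeSet, ⟨_, W, hW, rfl⟩, ?_⟩
      rw [hWe]
      refine Set.union_subset (fun g hg => hQX ?_) (by simpa using hfX)
      simp only [mem_edgeSet] at hg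
      simp [hg]
  -- If no other edge of the support touches `C`, the restriction of `z` to `C` is a kernel vector
  -- and equals `c` times the chain of a negative closed walk. Its boundary at the base vertex is
  -- `2c`, so `c = 0`, contradicting that `z` is nonzero on `C`.
  by_cases hiso : ∀ e ∈ X, e ∉ C → ∀ v ∈ verts G C, ¬ G.Inc e v
  · obtain ⟨v, W, hW, rfl⟩ := hC
    have hb : ∀ x ∈ W.support, boundary G s (z.filter (· ∈ W.edges)) x = 0 := by
      intro x hx
      have : boundary G s z x = 0 := by simp [hz]
      rw [← this]
      refine boundary_apply_congr fun f hf => ?_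
      by_cases hfW : f ∈ W.edges
      · simp [hfW]
      · by_contra hne
        have hfX : f ∈ X := by
          intro h0
          simp [hfW, h0] at hne
        exact hiso f hfX hfW x (by rw [hW.verts]; exact hx) hf
    obtain ⟨c, hc⟩ := eq_smul_chain_of_isSimpleClosed (s := s) hW
      (z := z.filter (· ∈ W.edges)) (fun f hf => by
        by_contra hf'
        simp [hf'] at hf) fun x hx _ => hb x hx
    have hneg : walkSign s W = -1 := by
      rcases Int.units_eq_one_or (walkSign s W) with h | h
      · exact absurd ⟨v, W, hW, rfl, h⟩ (hpos _ hCX)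
      · exact h
    have h0 := hb v W.start_mem_support
    rw [hc, map_smul, boundary_chain, hneg] at h0
    have hc0 : c = 0 := by
      norm_num at h0
      exact h0
    obtain ⟨e, he⟩ := List.exists_mem_of_ne_nil _ hW.1
    have h1 := DFunLike.congr_fun hc e
    simp [he, hc0] at h1
    exact hCX he h1
  · push Not at hiso
    obtain ⟨e, he, heC, v, hv, w, hvw⟩ := hiso
    obtain ⟨W₁, hW₁, rfl⟩ := hC.exists_walk hv
    have hV := hW₁.verts
    have hearF : ∀ {b : α} {Q : Walk G v b}, v ≠ b → b ∈ W₁.support → Q.IsPath →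
        Q.edgeSet ⊆ X → Disjoint Q.edgeSet W₁.edgeSet →
        (∀ x ∈ Q.support, x ∈ W₁.support → x = v ∨ x = b) → False := by
      intro b Q hvb hb hQ hQX hQC hs
      obtain ⟨D, hD, hp⟩ := exists_positive_of_ear (s := s) hC hvb hv (by rw [hV]; exact hb) hQ hQC
        (fun x hx hx' => hs x hx (by rw [hV] at hx'; exact hx'))
      exact hpos D (hD.trans (Set.union_subset hCX hQX)) hp
    have hout : ∀ {f : β} {x y : α}, G.IsLink f x y → y ∉ W₁.support → f ∉ W₁.edges :=
      fun hl hy hf => hy (mem_support_of_isLink hf hl.symm)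
    by_cases hwv : w = v
    · subst hwv
      refine hhand (Set.union_subset hCX (Set.singleton_subset_iff.2 he))
        (W₁ := W₁) (P := .nil hvw.left_mem) (W₂ := single e hvw)
        ⟨hW₁, ⟨by simp, by simp, by simp⟩, by simp [IsPath], ?_, by simp, by simp, by simp, ?_⟩
      · ext f
        simp [or_comm]
      · rintro f hf hf'
        simp only [edges_single, List.mem_singleton] at hf'
        exact heC (hf' ▸ hf)
    by_cases hwC : w ∈ W₁.support
    · refine hearF (Ne.symm hwv) hwC (isPath_single (h := hvw) (Ne.symm hwv)) ?_ ?_ (by simp)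
      · intro g hg
        simp at hg
        exact hg ▸ he
      · rw [Set.disjoint_left]
        intro g hg
        simp at hg
        exact hg ▸ heC
    -- Leave the cycle along `e` and continue until the walk meets itself or the cycle again. In the
    -- first case a handcuff arises, in the second an ear, which yields a positive cycle.
    · obtain ⟨t, Q, f, y, hQ, hQX, hQne, hQS, hfX, hf, hfty, hy⟩ :=
        exists_maximal_path hXfin hdeg {x | x ∈ W₁.support} (single e hvw)
          (isPath_single (Ne.symm hwv)) (by intro g hg; simp at hg; exact hg ▸ he) (by simp)
          (by simpa using hwC)
      have ht : t ∉ W₁.support := hQS t (end_mem_tailSupport hQne)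
      have hfC : f ∉ W₁.edges := hout hfty.symm ht
      have hQC : ∀ g ∈ Q.edges, g ∉ W₁.edges := by
        intro g hg
        obtain ⟨a, b, hs⟩ := exists_step hg
        obtain ⟨h1, -, h2, -⟩ := of_mem_steps hs
        exact hout h1 (hQS b h2)
      have hQv : ∀ x ∈ Q.support, x ∈ W₁.support → x = v := by
        intro x hx hx'
        by_contra hne
        exact hQS x (mem_tailSupport_of_ne hx hne) hx'
      by_cases hyQ : y ∈ Q.support
      · obtain ⟨A, B, W₂, rfl, hW₂, hWe, hWs⟩ := hclose hQ hf hfty hyQ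
        rw [isPath_append] at hQ
        have hAsup : ∀ x ∈ A.support, x ∈ (A.append B).support := fun x hx => by
          simp [support_append, hx]
        have hBsup : ∀ x ∈ B.support, x ∈ (A.append B).support := fun x hx => by
          by_cases hxy : x = y
          · exact hxy ▸ hyQ
          · simp [support_append, mem_tailSupport_of_ne hx hxy]
        refine hhand (D := W₁.edgeSet ∪ A.edgeSet ∪ W₂.edgeSet) ?_
          ⟨hW₁, hW₂, hQ.1, rfl, fun x hx => hQv x (hAsup x hx),
            fun x hx hx' => hQ.2.2 x hx ((hWs x).1 hx'), ?_, ?_⟩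
        · rw [hWe]
          refine Set.union_subset (Set.union_subset hCX fun g hg => hQX ?_)
            (Set.union_subset (fun g hg => hQX ?_) (by simpa using hfX))
          · simp only [mem_edgeSet] at hg
            simp [hg]
          · simp only [mem_edgeSet] at hg
            simp [hg]
        · intro x hx hx'
          have hxB := (hWs x).1 hx'
          obtain rfl := hQv x (hBsup x hxB) hx
          exact ⟨rfl, hQ.2.2 _ A.start_mem_support hxB⟩
        · intro g hg hg'
          have : g ∈ B.edgeSet ∪ {f} := hWe ▸ hg'
          rcases this with hgB | rfl
          · simp only [mem_edgeSet] at hgB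
            exact hQC g (by simp [hgB]) hg
          · exact hfC hg
      · have hyC : y ∈ W₁.support := by simpa [hyQ] using hy
        have hvy : v ≠ y := fun h => hyQ (h ▸ Q.start_mem_support)
        have hty : t ≠ y := fun h => hyQ (h ▸ Q.end_mem_support)
        refine hearF (Q := Q.append (single f hfty)) hvy hyC ?_ ?_ ?_ ?_
        · rw [isPath_append]
          refine ⟨hQ, isPath_single hty, fun x hx hx' => ?_⟩
          simp only [support_single, List.mem_cons, List.not_mem_nil, or_false] at hx'
          rcases hx' with rfl | rfl
          · rfl
          · exact absurd hx hyQ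
        · intro g hg
          simp only [mem_edgeSet, edges_append, edges_single, List.mem_append,
            List.mem_singleton] at hg
          rcases hg with hg | rfl
          · exact hQX hg
          · exact hfX
        · rw [Set.disjoint_left]
          intro g hg
          simp only [mem_edgeSet, edges_append, edges_single, List.mem_append,
            List.mem_singleton] at hg
          rcases hg with hg | rfl
          · exact hQC g hg
          · exact hfC
        · intro x hx hx'
          simp only [support_append, tailSupport_single, List.mem_append,
            List.mem_singleton] at hx
          rcases hx with hx | rfl
          · exact Or.inl (hQv x hx hx')
          · exact Or.inr rfl

end signedCircuits

/-! ### Matroids from rank functions and from vectors -/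

section rankFunctions

variable {β : Type*} {E : Set β} {r : Set β → ℤ}

lemma rankFunction_union_bounds (hE : E.Finite)
    (h1 : ∀ X ⊆ E, ∀ e ∈ E, r X ≤ r (insert e X) ∧ r (insert e X) ≤ r X + 1)
    {X Y : Set β} (hX : X ⊆ E) (hY : Y ⊆ E) :
    r X ≤ r (X ∪ Y) ∧ r (X ∪ Y) ≤ r X + Y.ncard := by
  induction Y, hE.subset hY using Set.Finite.induction_on with
  | empty => simp
  | @insert e Y he hYf ih =>
    obtain ⟨h2, h3⟩ := ih ((Set.subset_insert e Y).trans hY)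
    have h4 := h1 (X ∪ Y) (Set.union_subset hX ((Set.subset_insert e Y).trans hY)) e
      (hY (Set.mem_insert e Y))
    rw [Set.union_insert, Set.ncard_insert_of_notMem he hYf]
    push_cast
    omega

/-- Add the elements of `Y` one at a time: by `h2`, the remaining ones still do not raise the rank
after one of them has been added. -/
lemma rankFunction_union_eq (hE : E.Finite)
    (h2 : ∀ X ⊆ E, ∀ e ∈ E, ∀ f ∈ E, r (insert e X) = r X → r (insert f X) = r X →
      r (insert e (insert f X)) = r X)
    {X Y : Set β} (hX : X ⊆ E) (hY : Y ⊆ E) (h : ∀ e ∈ Y, r (insert e X) = r X) :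
    r (X ∪ Y) = r X := by
  induction Y, hE.subset hY using Set.Finite.induction_on generalizing X with
  | empty => simp
  | @insert e Y he hYf ih =>
    have heE := hY (Set.mem_insert e Y)
    have hYE := (Set.subset_insert e Y).trans hY
    have he' := h e (Set.mem_insert e Y)
    rw [Set.union_insert, ← Set.insert_union, ← he']
    refine ih (Set.insert_subset heE hX) hYE fun f hf => ?_
    rw [he']
    exact h2 X hX f (hYE hf) e heE (h f (Set.mem_insert_of_mem e hf)) he'

/-- A function with the local properties of a rank function is the rank function of a matroid. -/
theorem exists_hasRankFunction (hE : E.Finite) (h0 : r ∅ = 0)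
    (h1 : ∀ X ⊆ E, ∀ e ∈ E, r X ≤ r (insert e X) ∧ r (insert e X) ≤ r X + 1)
    (h2 : ∀ X ⊆ E, ∀ e ∈ E, ∀ f ∈ E, r (insert e X) = r X → r (insert f X) = r X →
      r (insert e (insert f X)) = r X) :
    ∃ M, HasRankFunction E r M := by
  have hle : ∀ X ⊆ E, r X ≤ X.ncard := fun X hX => by
    have := (rankFunction_union_bounds hE h1 (Set.empty_subset E) hX).2
    simpa [h0] using this
  let I : IndepMatroid β := IndepMatroid.ofFinite hE (fun I => I ⊆ E ∧ r I = I.ncard)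
    ⟨Set.empty_subset E, by simp [h0]⟩
    (by
      rintro I J ⟨hJ, hrJ⟩ hIJ
      refine ⟨hIJ.trans hJ, (hle I (hIJ.trans hJ)).antisymm ?_⟩
      have h3 := (rankFunction_union_bounds hE h1 (hIJ.trans hJ)
        (Set.sdiff_subset.trans hJ : J \ I ⊆ E)).2
      rw [Set.union_sdiff_cancel hIJ, hrJ] at h3
      have h4 := Set.ncard_sdiff_add_ncard_of_subset hIJ (hE.subset hJ)
      omega)
    (by
      rintro I J ⟨hI, hrI⟩ ⟨hJ, hrJ⟩ hlt
      by_contra! h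
      -- If no element of `J` augments `I`, none raises its rank. Then `r (I ∪ J) = r I`, which is
      -- smaller than `r J`, against monotonicity.
      have h3 : r (I ∪ J) = r I := by
        refine rankFunction_union_eq hE h2 hI hJ fun e he => ?_
        by_cases heI : e ∈ I
        · rw [Set.insert_eq_of_mem heI]
        · have h4 := h e he heI (Set.insert_subset (hJ he) hI)
          rw [Set.ncard_insert_of_notMem heI (hE.subset hI)] at h4
          have h5 := h1 I hI e (hJ he)
          push_cast at h4
          omega
      have h6 := (rankFunction_union_bounds hE h1 hJ hI).1
      rw [Set.union_comm] at h6
      omega)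
    (fun _ h => h.1)
  refine ⟨I.matroid, rfl, fun X hX => ?_⟩
  obtain ⟨B, hB⟩ := I.matroid.exists_isBasis X hX
  have hBI : B ⊆ E ∧ r B = B.ncard := hB.indep
  rw [rank, hB.eRk_eq_encard]
  have h3 : r (B ∪ X) = r B := by
    refine rankFunction_union_eq hE h2 hBI.1 hX fun e he => ?_
    by_cases heB : e ∈ B
    · rw [Set.insert_eq_of_mem heB]
    · have h4 : ¬ (insert e B ⊆ E ∧ r (insert e B) = (insert e B).ncard) := fun h4 =>
        heB (hB.mem_of_insert_indep he h4)
      rw [Set.ncard_insert_of_notMem heB (hE.subset hBI.1)] at h4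
      have h5 := h1 B hBI.1 e (hX he)
      have h6 : r (insert e B) ≠ (B.ncard + 1 : ℕ) := fun h6 =>
        h4 ⟨Set.insert_subset (hX he) hBI.1, h6⟩
      push_cast at h6
      omega
  rw [Set.union_eq_self_of_subset_left hB.subset] at h3
  rw [h3, hBI.2]
  rfl

open Module in
/-- Finitely many vectors represent a matroid. -/
theorem exists_linearMatroid {V : Type*} [AddCommGroup V] [Module ℚ V] (x : β → V)
    (hE : E.Finite) :
    ∃ M, HasRankFunction E (fun X => (finrank ℚ (Submodule.span ℚ (x '' X)) : ℤ)) M := by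
  have hfin : ∀ X ⊆ E, FiniteDimensional ℚ (Submodule.span ℚ (x '' X)) := fun X hX =>
    FiniteDimensional.span_of_finite ℚ ((hE.subset hX).image x)
  have hmem : ∀ X ⊆ E, ∀ e ∈ E,
      (finrank ℚ (Submodule.span ℚ (x '' (insert e X))) : ℤ) = finrank ℚ (Submodule.span ℚ (x '' X))
        ↔ x e ∈ Submodule.span ℚ (x '' X) := by
    intro X hX e he
    have := hfin (insert e X) (Set.insert_subset he hX)
    have hle : Submodule.span ℚ (x '' X) ≤ Submodule.span ℚ (x '' (insert e X)) :=
      Submodule.span_mono (Set.image_mono (Set.subset_insert e X))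
    rw [Nat.cast_inj]
    constructor
    · intro h
      rw [Submodule.eq_of_le_of_finrank_eq hle h.symm]
      exact Submodule.subset_span ⟨e, Set.mem_insert e X, rfl⟩
    · intro h
      rw [Set.image_insert_eq, Submodule.span_insert_eq_span h]
  refine exists_hasRankFunction hE
    (by rw [Set.image_empty, Submodule.span_empty, finrank_bot]; rfl) (fun X hX e he => ⟨?_, ?_⟩)
    fun X hX e he f hf h3 h4 => ?_
  · have := hfin (insert e X) (Set.insert_subset he hX)
    exact_mod_cast Submodule.finrank_mono
      (Submodule.span_mono (Set.image_mono (Set.subset_insert e X)))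
  · have := hfin X hX
    rw [Set.image_insert_eq, Submodule.span_insert]
    have h3 := Submodule.finrank_add_le_finrank_add_finrank (Submodule.span ℚ {x e})
      (Submodule.span ℚ (x '' X))
    have h4 : finrank ℚ (Submodule.span ℚ {x e}) ≤ 1 := by
      simpa using finrank_span_le_card (R := ℚ) ({x e} : Set V)
    omega
  · refine Eq.trans ?_ h4
    rw [hmem (insert f X) (Set.insert_subset hf hX) e he]
    exact Submodule.span_mono (Set.image_mono (Set.subset_insert f X)) ((hmem X hX e he).1 h3)

lemma indep_iff_rank_eq {M : Matroid β} {I : Set β} (hI : I.Finite) :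
    M.Indep I ↔ rank M I = I.ncard := by
  rw [M.indep_iff_eRk_eq_encard_of_finite hI, rank, ← hI.cast_ncard_eq]
  have : M.eRk I ≠ ⊤ := ((M.eRk_le_encard I).trans_lt hI.encard_lt_top).ne
  lift M.eRk I to ℕ using this with n
  simp

end rankFunctions

/-! ### The frame matroid as the matroid of the incidence matrix -/

section frameMatroid

variable {α β : Type*} (G : Graph α β) (s : β → ℤˣ)

/-- Clearing denominators: independence over `ℚ` can be tested on integral relations, the only ones
that have gains in an abelian group. -/
lemma linearIndepOn_incidence_iff (I : Set β) :
    LinearIndepOn ℚ (incidence G s) I ↔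
      ∀ z : β →₀ ℤ, (∀ e, z e ≠ 0 → e ∈ I) → boundary G s z = 0 → z = 0 := by
  rw [LinearIndepOn, ← LinearIndependent.iff_fractionRing ℤ ℚ, ← LinearIndepOn, linearIndepOn_iff]
  refine forall_congr' fun z => ?_
  rw [Finsupp.mem_supported]
  have : (z.support : Set β) ⊆ I ↔ ∀ e, z e ≠ 0 → e ∈ I := by
    simp [Set.subset_def]
  rw [this]
  rfl

open Module in
/-- The frame matroid of a finite signed graph, represented by the incidence matrix. -/
theorem exists_signedMatroid (hG : G.edgeSet.Finite) :
    ∃ M : Matroid β, M.E = G.edgeSet ∧ (∀ C, M.IsCircuit C ↔ IsSignedCircuit G s C) ∧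
      ∀ X ⊆ G.edgeSet,
        rank M X = (finrank ℚ (Submodule.span ℚ (incidence G s '' X)) : ℤ) := by
  obtain ⟨M, hME, hMr⟩ := exists_linearMatroid (incidence G s) hG
  refine ⟨M, hME, ?_, hMr⟩
  have hindep : ∀ I ⊆ G.edgeSet, M.Indep I ↔
      ∀ z : β →₀ ℤ, (∀ e, z e ≠ 0 → e ∈ I) → boundary G s z = 0 → z = 0 := by
    intro I hI
    have hIf := hG.subset hI
    rw [indep_iff_rank_eq hIf, hMr I hI, ← linearIndepOn_incidence_iff]
    have := hIf.fintype
    rw [LinearIndepOn, linearIndependent_iff_card_eq_finrank_span, Nat.cast_inj,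
      ← Set.image_eq_range, Set.finrank, Set.ncard_eq_toFinset_card', Set.toFinset_card, eq_comm]
  have hdep : ∀ X ⊆ G.edgeSet, ¬ M.Indep X ↔ ∃ C ⊆ X, IsSignedCircuit G s C := by
    intro X hX
    rw [hindep X hX]
    push Not
    constructor
    · rintro ⟨z, hz, hb, h0⟩
      obtain ⟨C, hC, hCz⟩ := exists_isSignedCircuit_of_boundary_eq_zero h0 hb
        fun e he => hX (hz e he)
      exact ⟨C, fun e he => hz e (hCz e he), hC⟩
    · rintro ⟨C, hCX, hC⟩
      obtain ⟨z, hb, hz, -⟩ := hC.exists_vector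
      obtain ⟨e, he⟩ := hC.nonempty
      refine ⟨z, fun f hf => hCX ((hz f).1 hf), hb, fun h0 => (hz e).2 he ?_⟩
      simp [h0]
  intro C
  constructor
  · intro hC
    have hCE : C ⊆ G.edgeSet := hME ▸ hC.subset_ground
    obtain ⟨D, hDC, hD⟩ := (hdep C hCE).1 hC.not_indep
    have := hC.eq_of_not_indep_subset ((hdep D (hDC.trans hCE)).2 ⟨D, subset_rfl, hD⟩) hDC
    exact this ▸ hD
  · intro hC
    have hCE := hC.subset_edgeSet
    rw [Matroid.isCircuit_iff]
    refine ⟨⟨(hdep C hCE).2 ⟨C, subset_rfl, hC⟩, hME ▸ hCE⟩, fun D hD hDC => ?_⟩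
    obtain ⟨D', hD', hD'c⟩ := (hdep D (hDC.trans hCE)).1 hD.not_indep
    have := hC.eq_of_subset hD'c (hD'.trans hDC)
    exact hDC.antisymm (this ▸ hD')

end frameMatroid

/-! ### Rank of the incidence matrix and positive components -/

section components

variable {α β : Type*} {G : Graph α β} {s : β → ℤˣ}

lemma Walk.exists_closed_of_not_isPath {u v : α} {W : Walk G u v} (hW : ¬ W.IsPath) :
    ∃ (x : α) (A : Walk G u x) (B : Walk G x x) (D : Walk G x v),
      W = A.append (B.append D) ∧ B.edges ≠ [] := by
  induction W with
  | nil => simp [IsPath] at hW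
  | @cons u v w e h W ih =>
    by_cases hu : u ∈ W.support
    · obtain ⟨A, B, rfl⟩ := exists_append_of_mem_support hu
      exact ⟨u, .nil h.left_mem, cons e h A, B, rfl, by simp⟩
    · obtain ⟨x, A, B, D, rfl, hB⟩ := ih fun hP => hW (isPath_cons.2 ⟨hu, hP⟩)
      exact ⟨x, cons e h A, B, D, rfl, hB⟩

/-- A closed walk is positive if all cycles formed by its edges are positive. -/
lemma walkSign_eq_one_of_closed {a : α} (W : Walk G a a)
    (h : ∀ (b : α) (W' : Walk G b b), W'.IsSimpleClosed → W'.edgeSet ⊆ W.edgeSet →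
      walkSign s W' = 1) : walkSign s W = 1 := by
  obtain ⟨n, hn⟩ : ∃ n, W.edges.length < n := ⟨_, Nat.lt_succ_self _⟩
  induction n generalizing a with
  | zero => omega
  | succ n ih =>
    cases W with
    | nil => simp
    | @cons _ v _ e he W =>
      by_cases hP : W.IsPath
      -- If the path `W` uses `e` again, it consists of `e` alone, and the closed walk goes back and
      -- forth along `e` with sign `s e * s e`.
      · by_cases heW : e ∈ W.edges
        · by_cases hva : v = a
          · subst hva
            cases W with
            | nil => simp at heW
            | cons f hf W => exact absurd W.end_mem_support (isPath_cons.1 hP).1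
          · rw [walkSign_cons, walkSign, hP.edges_eq_singleton hva heW he.symm]
            simp [Int.units_mul_self]
        · exact h a _ (isSimpleClosed_cons.2 ⟨hP, heW⟩) subset_rfl
      -- Cut out the closed subwalk `B`: both `B` and what remains are shorter closed walks.
      · obtain ⟨x, A, B, D, rfl, hB⟩ := exists_closed_of_not_isPath hP
        have hB' := List.length_pos_iff.2 hB
        have h1 : walkSign s B = 1 := by
          refine ih B (fun b W' hW' hs => h b W' hW' (hs.trans fun f hf => ?_)) ?_
          · simp only [mem_edgeSet] at hf
            simp [hf]
          · simp at hn
            omega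
        have h2 : walkSign s (cons e he (A.append D)) = 1 := by
          refine ih _ (fun b W' hW' hs => h b W' hW' (hs.trans fun f hf => ?_)) ?_
          · simp only [mem_edgeSet, edges_cons, edges_append, List.mem_cons, List.mem_append] at hf
            simp only [mem_edgeSet, edges_cons, edges_append, List.mem_cons, List.mem_append]
            tauto
          · simp at hn ⊢
            omega
        simpa [h1] using h2

variable (G) in
/-- There is a walk in `X` from `a` to `b`. -/
def Reach (X : Set β) (a b : α) : Prop :=
  ∃ W : Walk G a b, W.edgeSet ⊆ X

variable {X : Set β}

lemma Reach.symm {a b : α} (h : Reach G X a b) : Reach G X b a := by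
  obtain ⟨W, hW⟩ := h
  exact ⟨W.reverse, fun e he => hW (by simpa using he)⟩

lemma Reach.trans {a b c : α} (h : Reach G X a b) (h' : Reach G X b c) : Reach G X a c := by
  obtain ⟨W, hW⟩ := h
  obtain ⟨W', hW'⟩ := h'
  refine ⟨W.append W', fun e he => ?_⟩
  simp only [mem_edgeSet, edges_append, List.mem_append] at he
  exact he.elim (fun h => hW h) fun h => hW' h

lemma Reach.of_isLink {a b : α} {e : β} (he : e ∈ X) (h : G.IsLink e a b) : Reach G X a b :=
  ⟨single e h, fun f hf => by simp at hf; exact hf ▸ he⟩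

lemma mem_vertexSet_of_mem_verts {a : α} (ha : a ∈ verts G X) : a ∈ G.vertexSet := by
  obtain ⟨e, -, he⟩ := ha
  exact he.vertex_mem

lemma Reach.refl {a : α} (ha : a ∈ verts G X) : Reach G X a a :=
  ⟨.nil (mem_vertexSet_of_mem_verts ha), fun e he => by simp at he⟩

lemma nonempty_walk_edgeInduced_iff {a b : α} (ha : a ∈ verts G X) :
    Nonempty (Walk (edgeInduced G X) a b) ↔ Reach G X a b := by
  constructor
  · rintro ⟨W⟩
    induction W with
    | nil => exact Reach.refl ha
    | cons e h W ih => exact (Reach.of_isLink h.1 h.2).trans (ih ⟨e, h.1, _, h.2.symm⟩)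
  · rintro ⟨W, hW⟩
    induction W with
    | nil => exact ⟨.nil ha⟩
    | @cons u v w e h W ih =>
      have he : e ∈ X := hW (by simp)
      obtain ⟨W'⟩ := ih ⟨e, he, _, h.symm⟩ fun f hf => hW (by
        simp only [mem_edgeSet] at hf
        simp [hf])
      exact ⟨.cons e ⟨he, h⟩ W'⟩

lemma isComponent_edgeInduced_iff {S : Set α} :
    IsComponent (edgeInduced G X) S ↔ ∃ v ∈ verts G X, S = {w | Reach G X v w} := by
  refine exists_congr fun v => and_congr_right fun hv => ?_
  simp_rw [nonempty_walk_edgeInduced_iff hv]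

variable (G s) in
/-- The vertex sets of the components of `G[X]` without negative cycles. -/
def positiveComponents (X : Set β) : Set (Set α) :=
  {S : Set α | IsComponent (edgeInduced G X) S ∧
    ∀ C ⊆ X, IsCycle G C → verts G C ⊆ S → IsPositiveCycle G s C}

lemma walkSign_eq_one_of_mem_positiveComponents {S : Set α} (hS : S ∈ positiveComponents G s X)
    {a : α} (ha : a ∈ S) (W : Walk G a a) (hW : W.edgeSet ⊆ X) : walkSign s W = 1 := by
  obtain ⟨hS, hpos⟩ := hS
  obtain ⟨v, hv, rfl⟩ := isComponent_edgeInduced_iff.1 hS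
  refine walkSign_eq_one_of_closed W fun b W' hW' hs => ?_
  by_contra hne
  obtain ⟨b', W'', hW'', he, h1⟩ := hpos W'.edgeSet (hs.trans hW) ⟨b, W', hW', rfl⟩ (by
    rintro x ⟨e, he, y, hxy⟩
    obtain ⟨A, B, rfl⟩ := exists_append_of_mem_support (mem_support_of_isLink (hs he) hxy)
    exact ha.trans ⟨A, fun f hf => hW (by simp only [mem_edgeSet] at hf; simp [hf])⟩)
  apply hne
  rw [← h1]
  -- Positivity of the cycle is witnessed by some simple closed walk around it, perhaps not `W'`;
  -- both use each edge of the cycle once and so have equal sign.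
  refine walkSign_eq_of_perm ((List.perm_ext_iff_of_nodup hW'.2.1 hW''.2.1).2 fun f => ?_)
  rw [← mem_edgeSet, ← mem_edgeSet, he]

/-- Vectors orthogonal to the incidence vectors of the edges in `X`. -/
def IsPotential (s : β → ℤˣ) (f : verts G X → ℚ) : Prop :=
  ∀ (u v : verts G X), ∀ e ∈ X, G.IsLink e u v → f u = (s e : ℤ) * f v

lemma IsPotential.apply_eq {f : verts G X → ℚ} (hf : IsPotential s f) {a b : α} (W : Walk G a b)
    (hW : W.edgeSet ⊆ X) (ha : a ∈ verts G X) (hb : b ∈ verts G X) :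
    f ⟨a, ha⟩ = (walkSign s W : ℤ) * f ⟨b, hb⟩ := by
  induction W with
  | nil => simp
  | @cons u v w e h W ih =>
    have he : e ∈ X := hW (by simp)
    have hv : v ∈ verts G X := ⟨e, he, _, h.symm⟩
    rw [hf ⟨u, ha⟩ ⟨v, hv⟩ e he h, ih (fun f hf => hW (by
      simp only [mem_edgeSet] at hf
      simp [hf])) hv hb, walkSign_cons]
    push_cast
    ring

lemma positiveComponents_finite (hX : X.Finite) : (positiveComponents G s X).Finite := by
  refine ((verts_finite (G := G) hX).image fun v => {w | Reach G X v w}).subset ?_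
  rintro S ⟨hS, -⟩
  obtain ⟨v, hv, rfl⟩ := isComponent_edgeInduced_iff.1 hS
  exact ⟨v, hv, rfl⟩

-- A potential is determined on a component by its value at one vertex. On a component with a
-- negative cycle it equals its own negative and vanishes. On a positive component every value
-- extends by walk signs, consistently because closed walks are positive. So evaluation at one root
-- per positive component is an isomorphism.
open Module in
lemma finrank_potentials (hX : X.Finite) (K : Submodule ℚ (verts G X → ℚ))
    (hK : ∀ f, f ∈ K ↔ IsPotential s f) :
    finrank ℚ K = (positiveComponents G s X).ncard := by
  classical
  have := (positiveComponents_finite (G := G) (s := s) hX).fintype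
  have hroot : ∀ S : positiveComponents G s X, ∃ v : verts G X, S.1 = {w | Reach G X v w} := by
    rintro ⟨S, hS, -⟩
    obtain ⟨v, hv, rfl⟩ := isComponent_edgeInduced_iff.1 hS
    exact ⟨⟨v, hv⟩, rfl⟩
  choose root hroot using hroot
  have hmem : ∀ S, (root S : α) ∈ S.1 := fun S => by
    rw [hroot S]
    exact Reach.refl (root S).2
  let Θ : K →ₗ[ℚ] (positiveComponents G s X → ℚ) :=
    { toFun := fun f S => f.1 (root S)
      map_add' := fun _ _ => rfl
      map_smul' := fun _ _ => rfl }
  have hinj : Function.Injective Θ := by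
    rw [← LinearMap.ker_eq_bot, LinearMap.ker_eq_bot']
    rintro ⟨f, hf⟩ h0
    rw [hK] at hf
    ext ⟨x, hx⟩
    change f ⟨x, hx⟩ = 0
    have key : ∀ y (hy : y ∈ verts G X), Reach G X x y → f ⟨y, hy⟩ = 0 → f ⟨x, hx⟩ = 0 := by
      rintro y hy ⟨W, hW⟩ h0
      rw [hf.apply_eq W hW hx hy, h0, mul_zero]
    by_cases hb : {w | Reach G X x w} ∈ positiveComponents G s X
    · refine key _ (root ⟨_, hb⟩).2 ?_ (congrFun h0 ⟨_, hb⟩)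
      exact hmem ⟨_, hb⟩
    · have hcomp : IsComponent (edgeInduced G X) {w | Reach G X x w} :=
        isComponent_edgeInduced_iff.2 ⟨x, hx, rfl⟩
      have h1 : ∃ C ⊆ X, IsCycle G C ∧ verts G C ⊆ {w | Reach G X x w} ∧
          ¬ IsPositiveCycle G s C := by
        by_contra! h
        exact hb ⟨hcomp, h⟩
      obtain ⟨C, hCX, ⟨y, W, hW, rfl⟩, hCS, hneg⟩ := h1
      have hyC : y ∈ verts G W.edgeSet := by
        rw [hW.verts]
        exact W.start_mem_support
      refine key y (verts_mono hCX hyC) (hCS hyC) ?_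
      have h2 := hf.apply_eq W hCX (verts_mono hCX hyC) (verts_mono hCX hyC)
      have h3 : walkSign s W = -1 := by
        rcases Int.units_eq_one_or (walkSign s W) with h | h
        · exact absurd ⟨y, W, hW, rfl, h⟩ hneg
        · exact h
      rw [h3] at h2
      push_cast at h2
      linarith
  have hsurj : Function.Surjective Θ := by
    intro c
    -- The potential with value 1 at the root of `S` and value 0 outside `S`. By `hsg` it does not
    -- depend on the chosen walk to the root.
    let sg : positiveComponents G s X → α → ℚ := fun S x =>
      if h : Reach G X x (root S) then ((walkSign s h.choose : ℤ) : ℚ) else 0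
    have hsg : ∀ (S : positiveComponents G s X) (x : α) (W : Walk G x (root S)), W.edgeSet ⊆ X →
        sg S x = (walkSign s W : ℤ) := by
      intro S x W hW
      have h : Reach G X x (root S) := ⟨W, hW⟩
      simp only [sg, dif_pos h]
      have h1 := walkSign_eq_one_of_mem_positiveComponents S.2 (hmem S)
        (W.reverse.append h.choose) (fun e he => by
          simp only [mem_edgeSet, edges_append, edges_reverse, List.mem_append,
            List.mem_reverse] at he
          exact he.elim (fun h => hW h) fun h' => h.choose_spec h')
      rw [walkSign_append, walkSign_reverse] at h1
      have h2 : walkSign s h.choose = walkSign s W := by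
        rw [← one_mul (walkSign s h.choose), ← Int.units_mul_self (walkSign s W), mul_assoc, h1,
          mul_one]
      rw [h2]
    refine ⟨⟨fun x => ∑ S, sg S x * c S, ?_⟩, ?_⟩
    · rw [hK]
      intro u v e he h
      rw [Finset.mul_sum]
      refine Finset.sum_congr rfl fun S _ => ?_
      by_cases hv : Reach G X v (root S)
      · obtain ⟨W, hW⟩ := hv
        rw [hsg S v W hW, hsg S u (cons e h W) (fun f hf => by
          simp only [mem_edgeSet, edges_cons, List.mem_cons] at hf
          exact hf.elim (fun h => h ▸ he) fun h => hW h), walkSign_cons]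
        push_cast
        ring
      · have hu : ¬ Reach G X u (root S) := fun hu =>
          hv ((Reach.of_isLink he h.symm).trans hu)
        simp [sg, hu, hv]
    · ext S
      change ∑ T, sg T (root S) * c T = c S
      rw [Finset.sum_eq_single S]
      · rw [hsg S (root S) (.nil (mem_vertexSet_of_mem_verts (root S).2))
          (fun e he => by simp at he)]
        simp
      · intro T _ hTS
        have : ¬ Reach G X (root S) (root T) := by
          intro h
          apply hTS
          refine Subtype.ext ?_
          rw [hroot S, hroot T]
          ext x
          exact ⟨fun hx => h.trans hx, fun hx => h.symm.trans hx⟩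
        simp [sg, this]
      · simp
  rw [LinearEquiv.finrank_eq (LinearEquiv.ofBijective Θ ⟨hinj, hsurj⟩), finrank_fintype_fun_eq_card,
    Set.ncard_eq_toFinset_card', Set.toFinset_card]

open Module in
/-- The rank of the incidence matrix of a signed graph. -/
theorem finrank_span_incidence (hX : X.Finite) (hXG : X ⊆ G.edgeSet) :
    finrank ℚ (Submodule.span ℚ (incidence G s '' X)) + (positiveComponents G s X).ncard =
      (verts G X).ncard := by
  classical
  have := hX.fintype
  have := (verts_finite (G := G) hX).fintype
  let A : Matrix X (verts G X) ℚ := fun e v => incidence G s e v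
  let L : (α →₀ ℚ) →ₗ[ℚ] (verts G X → ℚ) :=
    { toFun := fun f v => f v
      map_add' := fun _ _ => rfl
      map_smul' := fun _ _ => rfl }
  -- The columns of the edges in `X` vanish outside `verts G X`, so restricting coordinates is
  -- injective on their span.
  have hrank : finrank ℚ (Submodule.span ℚ (incidence G s '' X)) = A.rank := by
    rw [Matrix.rank_eq_finrank_span_row]
    have h1 : Set.range A.row = L '' (incidence G s '' X) := by
      rw [← Set.image_comp, Set.image_eq_range]
      rfl
    rw [h1, ← Submodule.map_span, ← LinearMap.range_domRestrict]
    refine (LinearMap.finrank_range_of_inj ?_).symm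
    rw [← LinearMap.ker_eq_bot, LinearMap.ker_eq_bot']
    rintro ⟨f, hf⟩ h0
    have hsupp : Submodule.span ℚ (incidence G s '' X) ≤ Finsupp.supported ℚ ℚ (verts G X) := by
      rw [Submodule.span_le]
      rintro _ ⟨e, he, rfl⟩
      rw [SetLike.mem_coe, Finsupp.mem_supported']
      exact fun x hx => incidence_of_not_inc fun h => hx ⟨e, he, h⟩
    ext x
    by_cases hx : x ∈ verts G X
    · exact congrFun h0 ⟨x, hx⟩
    · exact (Finsupp.mem_supported' _ _).1 (hsupp hf) x hx
  -- Up to the sign `dir`, the row of `e` applied to `f` is `f u - s e * f v`, so the null space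
  -- consists of the potentials and rank-nullity finishes.
  have hker := finrank_potentials (s := s) hX (LinearMap.ker A.mulVecLin) (by
    intro f
    have key : ∀ (e : X) (u v : verts G X), G.IsLink e u v →
        ((dir G s e u v : ℤ) : ℚ) * A.mulVec f e = f u - (s e : ℤ) * f v := by
      intro e u v h
      have h1 : ∀ x : verts G X, ((dir G s e u v : ℤ) : ℚ) * incidence G s e x =
          (if u = x then 1 else 0) - ((s e : ℤ) : ℚ) * (if v = x then 1 else 0) := by
        intro x
        have := DFunLike.congr_fun (dir_smul_incidence (s := s) h) (x : α)
        simpa [Finsupp.single_apply, Subtype.ext_iff] using this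
      rw [Matrix.mulVec, dotProduct, Finset.mul_sum]
      simp_rw [← mul_assoc]
      change ∑ x : verts G X, ((dir G s e u v : ℤ) : ℚ) * incidence G s e x * f x = _
      simp_rw [h1, sub_mul, Finset.sum_sub_distrib, mul_assoc, ite_mul]
      simp
    rw [LinearMap.mem_ker, Matrix.mulVecLin_apply]
    constructor
    · intro h u v e he huv
      have := key ⟨e, he⟩ u v huv
      rw [h] at this
      simp at this
      linarith
    · intro h
      ext ⟨e, he⟩
      obtain ⟨u, v, huv⟩ := G.exists_isLink_of_mem_edgeSet (hXG he)
      have h1 := key ⟨e, he⟩ ⟨u, e, he, v, huv⟩ ⟨v, e, he, u, huv.symm⟩ huv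
      rw [h ⟨u, e, he, v, huv⟩ ⟨v, e, he, u, huv.symm⟩ e he huv, sub_self] at h1
      have h2 : ((dir G s e u v : ℤ) : ℚ) ≠ 0 := by
        rcases Int.units_eq_one_or (dir G s e u v) with h | h <;> simp [h]
      simpa [h2] using h1)
  rw [hrank, ← hker, Matrix.rank, LinearMap.finrank_range_add_finrank_ker,
    finrank_fintype_fun_eq_card, Set.ncard_eq_toFinset_card', Set.toFinset_card]

end components

/-! ### Sign and chain of a circuit walk -/

section parity

variable {α β : Type*} {G : Graph α β} {s : β → ℤˣ}

-- Edges in a cycle of `C` are traversed once by definition. Any other edge lies on the path of a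
-- handcuff; there the unsigned chain of a closed walk vanishes, so the number of traversals is
-- even.
open Classical in
lemma IsCircuitWalk.count_cast_eq {C : Set β} (hC : IsSignedCircuit G s C) {v w : α}
    {W : Walk G v v} {W' : Walk G w w} (hW : IsCircuitWalk C W) (hW' : IsCircuitWalk C W') (e : β) :
    (W.edges.count e : ZMod 2) = W'.edges.count e := by
  by_cases heC : e ∈ C
  swap
  · have h1 : e ∉ W.edges := fun h => heC (hW.1 ▸ h)
    have h2 : e ∉ W'.edges := fun h => heC (hW'.1 ▸ h)
    rw [List.count_eq_zero.2 h1, List.count_eq_zero.2 h2]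
  by_cases hcyc : ∃ D ⊆ C, IsCycle G D ∧ e ∈ D
  · obtain ⟨D, hDC, hD, he⟩ := hcyc
    rw [hW.2 D hDC hD e he, hW'.2 D hDC hD e he]
  rcases hC.cases with h | ⟨a, b, W₁, P, W₂, h, -⟩
  · exact absurd ⟨C, subset_rfl, h.isCycle, heC⟩ hcyc
  · have heP : e ∈ P.edges := by
      have h1 : W₁.edgeSet ⊆ C := by
        rw [h.eq_union, Set.union_assoc]
        exact Set.subset_union_left
      have h2 : W₂.edgeSet ⊆ C := by
        rw [h.eq_union]
        exact Set.subset_union_right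
      have h3 := heC
      rw [h.eq_union] at h3
      rcases h3 with (h3 | h3) | h3
      · exact absurd ⟨_, h1, ⟨a, W₁, h.left, rfl⟩, h3⟩ hcyc
      · exact h3
      · exact absurd ⟨_, h2, ⟨b, W₂, h.right, rfl⟩, h3⟩ hcyc
    have key : ∀ {x : α} (T : Walk G x x), T.edgeSet = C → (T.edges.count e : ZMod 2) = 0 := by
      intro x T hT
      rw [← chain_apply_cast (s := fun _ => 1) T e, h.apply_eq_zero_of_unsigned (fun f hf => ?_)
        (by simp [boundary_chain, walkSign_one]) heP, Int.cast_zero]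
      rw [← hT]
      by_contra hfT
      exact hf (chain_apply_of_notMem hfT)
    rw [key W hW.1, key W' hW'.1]

lemma intUnits_pow_congr (t : ℤˣ) {m n : ℕ} (h : (m : ZMod 2) = n) : t ^ m = t ^ n := by
  rw [ZMod.natCast_eq_natCast_iff] at h
  rw [Int.units_pow_eq_pow_mod_two, h, ← Int.units_pow_eq_pow_mod_two]

/-- The sign of a walk depends only on the parity with which each edge is used. -/
lemma IsCircuitWalk.walkSign_eq {C : Set β} (hC : IsSignedCircuit G s C) {v w : α}
    {W : Walk G v v} {W' : Walk G w w} (hW : IsCircuitWalk C W) (hW' : IsCircuitWalk C W') :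
    walkSign s W = walkSign s W' := by
  classical
  have hset : W.edges.toFinset = W'.edges.toFinset := by
    ext e
    rw [List.mem_toFinset, List.mem_toFinset, ← mem_edgeSet, ← mem_edgeSet, hW.1, hW'.1]
  rw [walkSign, walkSign, Finset.prod_list_map_count, Finset.prod_list_map_count, hset]
  refine Finset.prod_congr rfl fun e _ => intUnits_pow_congr _ ?_
  convert hW.count_cast_eq hC hW' e

open Classical in
lemma exists_isCircuitWalk_of_isPositiveCycle {v : α} {W : Walk G v v} (hW : W.IsSimpleClosed) :
    IsCircuitWalk W.edgeSet W :=
  ⟨rfl, fun _ hD _ _ he => List.count_eq_one_of_mem hW.2.1 (hD he)⟩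

variable {C : Set β} {u v : α} {W₁ : Walk G u u} {P : Walk G u v} {W₂ : Walk G v v}

lemma IsHandcuffOf.isCircuitWalk (h : IsHandcuffOf C W₁ P W₂) :
    IsCircuitWalk C (W₁.append (P.append (W₂.append P.reverse))) := by
  classical
  constructor
  · rw [h.eq_union]
    ext e
    simp only [mem_edgeSet, edges_append, edges_reverse, List.mem_append, List.mem_reverse,
      Set.mem_union]
    tauto
  · rintro D hDC ⟨w, W, hW, rfl⟩ e he
    -- No cycle in `C` uses the path: its unsigned chain would have to vanish there but takes the
    -- value ±1 on its edges.
    have heP : e ∉ P.edges := by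
      intro heP
      have h0 := h.apply_eq_zero_of_unsigned (z := chain (fun _ => 1) W) (fun f hf => hDC (by
        by_contra hfW
        exact hf (chain_apply_of_notMem hfW)) ) (by simp [boundary_chain, walkSign_one]) heP
      rcases chain_apply_of_nodup (s := fun _ => 1) hW.2.1 he with h1 | h1 <;> simp [h1] at h0
    have hePr : e ∉ P.reverse.edges := by simpa using heP
    simp only [edges_append, List.count_append, List.count_eq_zero.2 heP,
      List.count_eq_zero.2 hePr, zero_add, add_zero]
    have heC := hDC he
    rw [h.eq_union] at heC
    rcases heC with (h1 | h1) | h1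
    · rw [List.count_eq_zero.2 (h.disjoint e h1), add_zero]
      exact List.count_eq_one_of_mem h.left.2.1 h1
    · exact absurd h1 heP
    · rw [List.count_eq_zero.2 (fun h2 => h.disjoint e h2 h1), zero_add]
      exact List.count_eq_one_of_mem h.right.2.1 h1

lemma IsSignedCircuit.exists_isCircuitWalk (hC : IsSignedCircuit G s C) :
    ∃ (v : α) (W : Walk G v v), IsCircuitWalk C W ∧ walkSign s W = 1 := by
  rcases hC.cases with ⟨v, W, hW, rfl, h1⟩ | ⟨a, b, W₁, P, W₂, h, h₁, h₂⟩
  · exact ⟨v, W, exists_isCircuitWalk_of_isPositiveCycle hW, h1⟩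
  · exact ⟨a, _, h.isCircuitWalk, by simp [h₁, h₂, Int.units_mul_self]⟩

lemma IsCircuitWalk.walkSign_eq_one (hC : IsSignedCircuit G s C) {W : Walk G v v}
    (hW : IsCircuitWalk C W) : walkSign s W = 1 := by
  obtain ⟨w, W', hW', h1⟩ := hC.exists_isCircuitWalk
  rw [hW.walkSign_eq hC hW', h1]

/-- The chain of a circuit walk is determined by the circuit up to its sign. -/
lemma IsCircuitWalk.chain_eq (hC : IsSignedCircuit G s C) {W : Walk G v v}
    (hW : IsCircuitWalk C W) {z : β →₀ ℤ}
    (hz : ∀ y : β →₀ ℤ, boundary G s y = 0 → (∀ e, y e ≠ 0 → e ∈ C) → ∃ c : ℤ, y = c • z) :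
    chain s W = z ∨ chain s W = -z := by
  classical
  obtain ⟨c, hc⟩ := hz (chain s W) (by simp [boundary_chain, hW.walkSign_eq_one hC]) (fun e he => by
    rw [← hW.1]
    by_contra h
    exact he (chain_apply_of_notMem h))
  obtain ⟨D, hDC, hD⟩ := hC.exists_isCycle
  obtain ⟨e, he⟩ := hD.nonempty
  have h1 : chain s W e = 1 ∨ chain s W e = -1 :=
    chain_apply_of_count_eq_one (by convert hW.2 D hDC hD e he)
  -- At an edge of a cycle, traversed once, the coefficient `c * z e` of the chain is ±1, which
  -- forces `c` to be ±1.
  have h2 : IsUnit (c * z e) := by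
    rw [hc] at h1
    rw [Int.isUnit_iff]
    simpa using h1
  rcases Int.isUnit_iff.1 (isUnit_of_mul_isUnit_left h2) with rfl | rfl
  · exact Or.inl (by simpa using hc)
  · exact Or.inr (by simpa using hc)

end parity

/-! ### Gains of integral chains -/

namespace GainFunction

variable {α β Γ₁ : Type*} [CommGroup Γ₁] {G : Graph α β}
  (ψ : GainFunction G (SignedGroup Γ₁))

open Classical in
/-- The sign of an edge. -/
noncomputable def sign (e : β) : ℤˣ :=
  if h : ∃ p : α × α, G.IsLink e p.1 p.2 then (ψ.val e h.choose.1 h.choose.2).right else 1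

open Classical in
/-- The gain of an edge in its chosen orientation. -/
noncomputable def gain (e : β) : Additive Γ₁ :=
  if h : ∃ p : α × α, G.IsLink e p.1 p.2 then
    Additive.ofMul (ψ.val e h.choose.1 h.choose.2).left
  else 0

/-- The gain of an integral chain. -/
noncomputable def chainGain : (β →₀ ℤ) →ₗ[ℤ] Additive Γ₁ :=
  Finsupp.linearCombination ℤ ψ.gain

variable {ψ}

lemma sign_eq {e : β} {u v : α} (h : G.IsLink e u v) : (ψ.val e u v).right = ψ.sign e := by
  have hp : ∃ p : α × α, G.IsLink e p.1 p.2 := ⟨(u, v), h⟩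
  rw [sign, dif_pos hp]
  rcases h.eq_and_eq_or_eq_and_eq hp.choose_spec with ⟨h1, h2⟩ | ⟨h1, h2⟩
  · rw [← h1, ← h2]
  · rw [← h1, ← h2]
    by_cases huv : u = v
    · rw [huv]
    · rw [ψ.val_swap e u v h huv, SemidirectProduct.inv_right, Int.units_inv_eq_self]

/-- Inversion in the semidirect product multiplies `φ` by `-σ(e)`, the same factor by which
reversing a non-loop edge changes its incidence vector. Hence gains and boundaries can be computed
from the same chain. -/
lemma dir_smul_gain {e : β} {u v : α} (h : G.IsLink e u v) :
    (dir G ψ.sign e u v : ℤ) • ψ.gain e = Additive.ofMul (ψ.val e u v).left := by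
  have hp : ∃ p : α × α, G.IsLink e p.1 p.2 := ⟨(u, v), h⟩
  rw [gain, dir, dif_pos hp]
  by_cases huv : (u, v) = hp.choose
  · rw [if_pos ⟨hp, huv⟩, ← huv]
    simp
  · rw [if_neg (by rintro ⟨_, h'⟩; exact huv h')]
    rcases h.eq_and_eq_or_eq_and_eq hp.choose_spec with ⟨h1, h2⟩ | ⟨h1, h2⟩
    · exact absurd (Prod.ext h1 h2) huv
    · have hne : u ≠ v := by
        rintro rfl
        exact huv (Prod.ext h2 h1)
      rw [← h1, ← h2, ψ.val_swap e u v h hne, SemidirectProduct.inv_left, sign_eq h,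
        Int.units_inv_eq_self]
      rw [show (signAction Γ₁ (ψ.sign e)) ((ψ.val e u v).left⁻¹) =
        (ψ.val e u v).left⁻¹ ^ (ψ.sign e : ℤ) from rfl, ← ofMul_zpow, ← zpow_mul]
      rcases Int.units_eq_one_or (ψ.sign e) with hs | hs <;> simp [hs]

lemma walkVal_nil {v : α} (hv : v ∈ G.vertexSet) : ψ.walkVal (.nil hv) = 1 := by
  simp [walkVal]

lemma walkVal_cons {u v w : α} (e : β) (h : G.IsLink e u v) (W : Walk G v w) :
    ψ.walkVal (.cons e h W) = ψ.val e u v * ψ.walkVal W := by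
  simp [walkVal]

lemma walkVal_right {u v : α} (W : Walk G u v) : (ψ.walkVal W).right = walkSign ψ.sign W := by
  induction W with
  | nil => simp [walkVal_nil]
  | cons e h W ih => simp [walkVal_cons, ih, sign_eq h]

/-- The recursion defining `chain` is the multiplication rule of the semidirect product: later terms
are multiplied by the sign of the first edge. -/
lemma chainGain_chain {u v : α} (W : Walk G u v) :
    ψ.chainGain (chain ψ.sign W) = Additive.ofMul (ψ.walkVal W).left := by
  induction W with
  | nil => simp [walkVal_nil]
  | cons e h W ih =>
    rw [chain_cons, map_add, map_smul, ih, walkVal_cons, SemidirectProduct.mul_left, ofMul_mul,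
      sign_eq h, chainGain, Finsupp.linearCombination_single, dir_smul_gain h]
    rfl

lemma signedWalkGain_eq {u v : α} (W : Walk G u v) :
    ψ.signedWalkGain W = (ψ.walkVal W).left := by
  induction W with
  | nil hv =>
    rw [walkVal_nil]
    have : IsEmpty (Fin (Walk.nil hv).steps.length) := by
      rw [steps_nil]
      exact Fin.isEmpty'
    exact Fintype.prod_empty _
  | @cons u v w e h W ih =>
    rw [walkVal_cons, SemidirectProduct.mul_left, ← ih, signedWalkGain, sign_eq h]
    change ∏ i : Fin (W.steps.length + 1), _ = _
    rw [Fin.prod_univ_succ]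
    congr 1
    · exact zpow_one _
    · change _ = (signedWalkGain ψ W) ^ (ψ.sign e : ℤ)
      rw [signedWalkGain, ← Finset.prod_zpow]
      refine Finset.prod_congr rfl fun i _ => ?_
      rw [← zpow_mul]
      congr 1
      have : ψ.signPart (e, u, v) = ψ.sign e := sign_eq h
      simp [this, mul_comm]

lemma walkVal_eq_one_iff {u : α} {W : Walk G u u} (h : walkSign ψ.sign W = 1) :
    ψ.walkVal W = 1 ↔ ψ.signedWalkGain W = 1 := by
  rw [signedWalkGain_eq, SemidirectProduct.ext_iff, walkVal_right, h]
  simp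

/-- The chain of `W` is `z` or `-z`, so whether the gain vanishes depends on the circuit alone. -/
lemma signedWalkGain_eq_one_iff {C : Set β} (hC : IsSignedCircuit G ψ.sign C) {v : α}
    {W : Walk G v v} (hW : IsCircuitWalk C W) {z : β →₀ ℤ}
    (hz : ∀ y : β →₀ ℤ, boundary G ψ.sign y = 0 → (∀ e, y e ≠ 0 → e ∈ C) → ∃ c : ℤ, y = c • z) :
    ψ.signedWalkGain W = 1 ↔ ψ.chainGain z = 0 := by
  rw [signedWalkGain_eq, ← ofMul_eq_zero, ← chainGain_chain]
  rcases hW.chain_eq hC hz with h | h <;> simp [h]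

lemma isNeutral_iff_chainGain {C : Set β} (hC : IsSignedCircuit G ψ.sign C) {z : β →₀ ℤ}
    (hz : ∀ y : β →₀ ℤ, boundary G ψ.sign y = 0 → (∀ e, y e ≠ 0 → e ∈ C) → ∃ c : ℤ, y = c • z) :
    ψ.IsNeutral C ↔ ψ.chainGain z = 0 := by
  constructor
  · rintro ⟨v, W, hW, h1⟩
    exact (signedWalkGain_eq_one_iff hC hW hz).1 h1
  · intro h
    obtain ⟨v, W, hW, -⟩ := hC.exists_isCircuitWalk
    exact ⟨v, W, hW, (signedWalkGain_eq_one_iff hC hW hz).2 h⟩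

lemma signedWalkGain_eq_one_iff_isNeutral {C : Set β} (hC : IsSignedCircuit G ψ.sign C) {v : α}
    {W : Walk G v v} (hW : IsCircuitWalk C W) : ψ.signedWalkGain W = 1 ↔ ψ.IsNeutral C := by
  obtain ⟨z, -, -, -, hz⟩ := hC.exists_vector
  rw [signedWalkGain_eq_one_iff hC hW hz, isNeutral_iff_chainGain hC hz]

/-- The subgroup `translations Γ₁` is the kernel of the projection to the signs. -/
lemma quot_walkVal_eq_one_iff {u v : α} (W : Walk G u v) :
    (ψ.quot (translations Γ₁)).walkVal W = 1 ↔ walkSign ψ.sign W = 1 := by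
  have h : (ψ.quot (translations Γ₁)).walkVal W =
      (QuotientGroup.mk' (translations Γ₁)) (ψ.walkVal W) := by
    rw [walkVal, walkVal, map_list_prod, List.map_map]
    rfl
  rw [h, ← MonoidHom.mem_ker, QuotientGroup.ker_mk', translations,
    SemidirectProduct.range_inl_eq_ker_rightHom, MonoidHom.mem_ker, ← walkVal_right]
  rfl

lemma quot_isBalancedCycle_iff {C : Set β} :
    (ψ.quot (translations Γ₁)).IsBalancedCycle C ↔ IsPositiveCycle G ψ.sign C := by
  simp_rw [IsBalancedCycle, quot_walkVal_eq_one_iff, IsPositiveCycle]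

lemma quot_isFrameCircuit_iff {C : Set β} :
    (ψ.quot (translations Γ₁)).IsFrameCircuit C ↔ IsSignedCircuit G ψ.sign C := by
  simp_rw [IsFrameCircuit, quot_isBalancedCycle_iff, IsSignedCircuit]

lemma quot_numBalancedComponents (X : Set β) :
    (ψ.quot (translations Γ₁)).numBalancedComponents X =
      (positiveComponents G ψ.sign X).ncard := by
  simp_rw [numBalancedComponents, quot_isBalancedCycle_iff, positiveComponents]

end GainFunction

/-! ### Switching along paths, cycles and handcuffs -/

section potentials

variable {α β Γ : Type*} [Group Γ] {G : Graph α β}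

/-- The values of `h` at the vertices of `W` differ by the gains of the edges of `W`. -/
def GainFunction.IsConsistent (ψ : GainFunction G Γ) (h : α → Γ) (X : Set β) : Prop :=
  ∀ e ∈ X, ∀ a b, G.IsLink e a b → h b = h a * ψ.val e a b

namespace GainFunction

variable {ψ : GainFunction G Γ}

lemma IsConsistent.apply_eq {h : α → Γ} {X : Set β} (hh : ψ.IsConsistent h X) {u v : α}
    (W : Walk G u v) (hW : W.edgeSet ⊆ X) : h v = h u * ψ.walkVal W := by
  induction W with
  | nil => simp [walkVal]
  | @cons u v w e he W ih =>
    rw [ih fun f hf => hW (by simp only [mem_edgeSet] at hf; simp [hf]),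
      hh e (hW (by simp)) u v he]
    simp [walkVal, mul_assoc]

/-- Starting from `h₀ u`, the values along the path are forced edge by edge. No vertex repeats, so
there is no conflict, and vertices of `S` are not overwritten. -/
lemma exists_isConsistent_of_isPath {u v : α} {W : Walk G u v} (hW : W.IsPath) {S : Set α}
    (hS : ∀ x ∈ W.tailSupport, x ∉ S) (h₀ : α → Γ) :
    ∃ h : α → Γ, h u = h₀ u ∧ (∀ x ∈ S, h x = h₀ x) ∧ ψ.IsConsistent h W.edgeSet := by
  classical
  induction W generalizing S h₀ with
  | nil => exact ⟨h₀, rfl, fun _ _ => rfl, fun e he => by simp at he⟩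
  | @cons u v w e he W ih =>
    obtain ⟨hu, hW'⟩ := isPath_cons.1 hW
    have huv : u ≠ v := fun huv => hu (huv ▸ W.start_mem_support)
    rw [tailSupport_cons] at hS
    obtain ⟨h, hv, hh, hcons⟩ := ih hW' (S := insert u S) (fun x hx => by
      simp only [Set.mem_insert_iff, not_or]
      refine ⟨?_, hS x (mem_support_of_mem_tailSupport hx)⟩
      rintro rfl
      exact hu (mem_support_of_mem_tailSupport hx)) (Function.update h₀ v (h₀ u * ψ.val e u v))
    have hhu : h u = h₀ u := by
      rw [hh u (by simp), Function.update_of_ne huv]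
    rw [Function.update_self] at hv
    refine ⟨h, hhu, fun x hx => ?_, fun f hf a b hab => ?_⟩
    · have : x ≠ v := by
        rintro rfl
        exact hS _ W.start_mem_support hx
      rw [hh x (by simp [hx]), Function.update_of_ne this]
    · simp only [mem_edgeSet, edges_cons, List.mem_cons] at hf
      rcases hf with rfl | hf
      · rcases hab.eq_and_eq_or_eq_and_eq he with ⟨rfl, rfl⟩ | ⟨rfl, rfl⟩
        · rw [hv, hhu]
        · rw [hv, hhu, ψ.val_swap f b a he huv]
          group
      · exact hcons f hf a b hab

/-- The gain of an edge after switching by the inverse of `h`. -/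
def switchedBy (ψ : GainFunction G Γ) (h : α → Γ) (e : β) (a b : α) : Γ :=
  h a * ψ.val e a b * (h b)⁻¹

lemma switchedBy_mem_of_isLink {h : α → Γ} {e : β} {a b c d : α} {A : Subgroup Γ}
    (hab : G.IsLink e a b) (hcd : G.IsLink e c d) (hA : ψ.switchedBy h e a b ∈ A) :
    ψ.switchedBy h e c d ∈ A := by
  rcases hcd.eq_and_eq_or_eq_and_eq hab with ⟨rfl, rfl⟩ | ⟨rfl, rfl⟩
  · exact hA
  · by_cases hcd' : d = c
    · subst hcd'
      exact hA
    · have : ψ.switchedBy h e c d = (ψ.switchedBy h e d c)⁻¹ := by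
        rw [switchedBy, switchedBy, ψ.val_swap e d c hab hcd']
        group
      rw [this]
      exact A.inv_mem hA

lemma IsConsistent.switchedBy_mem {h : α → Γ} {X : Set β} (hh : ψ.IsConsistent h X)
    (A : Subgroup Γ) {e : β} (he : e ∈ X) {a b : α} (hab : G.IsLink e a b) :
    ψ.switchedBy h e a b ∈ A := by
  rw [switchedBy, hh e he a b hab, mul_inv_cancel]
  exact A.one_mem

/-- Choose `h` consistent along all edges but the first. Then the whole gain of the cycle,
conjugated by `h v`, sits on the first edge. The set `S` protects values already chosen elsewhere.
-/
lemma exists_switchedBy_mem_of_isSimpleClosed {v : α} {W : Walk G v v} (hW : W.IsSimpleClosed)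
    {S : Set α} (hS : ∀ x ∈ W.support, x ∈ S → x = v) (h₀ : α → Γ) :
    ∃ h : α → Γ, h v = h₀ v ∧ (∀ x ∈ S, h x = h₀ x) ∧ ∀ A : Subgroup Γ,
      h v * ψ.walkVal W * (h v)⁻¹ ∈ A → ∀ e ∈ W.edges, ∀ a b, G.IsLink e a b →
        ψ.switchedBy h e a b ∈ A := by
  cases W with
  | nil => exact absurd rfl hW.1
  | @cons _ w _ e he W =>
    obtain ⟨hP, -⟩ := isSimpleClosed_cons.1 hW
    obtain ⟨h, hv, hhS, hh⟩ := exists_isConsistent_of_isPath (ψ := ψ) hP.reverse (S := S)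
      (fun x hx hxS => by
        have hx' := mem_support_of_mem_tailSupport hx
        rw [support_reverse, List.mem_reverse] at hx'
        obtain rfl := hS x (by simp [hx']) hxS
        exact hP.reverse.start_notMem hx) h₀
    refine ⟨h, hv, hhS, fun A hA f hf a b hab => ?_⟩
    have hh' : ψ.IsConsistent h W.edgeSet := fun f hf => hh f (by simpa using hf)
    simp only [edges_cons, List.mem_cons] at hf
    rcases hf with rfl | hf
    · refine switchedBy_mem_of_isLink he hab ?_
      have h1 := hh'.apply_eq W subset_rfl
      have h2 : ψ.switchedBy h f v w = h v * ψ.walkVal (.cons f he W) * (h v)⁻¹ := by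
        rw [switchedBy]
        nth_rewrite 3 [h1]
        simp [walkVal, mul_assoc]
      rwa [h2]
    · exact hh'.switchedBy_mem A hf hab

lemma switch_inv_valSet_subset {h : α → Γ} {C : Set β} {A : Subgroup Γ}
    (hA : ∀ e ∈ C, ∀ a b, G.IsLink e a b → ψ.switchedBy h e a b ∈ A) :
    (ψ.switch fun x => (h x)⁻¹).valSet C ⊆ (A : Set Γ) := by
  rintro _ ⟨e, he, a, b, hab, rfl⟩
  simpa [switch, switchedBy] using hA e he a b hab

lemma mem_of_switch_valSet_subset {η : α → Γ} {C : Set β} {A : Subgroup Γ}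
    (hA : (ψ.switch η).valSet C ⊆ (A : Set Γ)) {u v : α} (W : Walk G u v) (hW : W.edgeSet ⊆ C) :
    (η u)⁻¹ * ψ.walkVal W * η v ∈ A := by
  induction W with
  | nil => simp [walkVal]
  | @cons u v w e he W ih =>
    have h1 := ih fun f hf => hW (by simp only [mem_edgeSet] at hf; simp [hf])
    have h2 : (η u)⁻¹ * ψ.val e u v * η v ∈ A := hA ⟨e, hW (by simp), u, v, he, rfl⟩
    have := A.mul_mem h2 h1
    simpa [walkVal, mul_assoc] using this

/-- A handcuff on which the gains of the two cycles agree up to the gain of the connecting path can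
be switched so that all its gains lie in a subgroup containing the gain of a cycle. -/
lemma exists_switch_valSet_subset {C : Set β} {u v : α} {W₁ : Walk G u u}
    {P : Walk G u v} {W₂ : Walk G v v} (h : IsHandcuffOf C W₁ P W₂)
    (h1 : ψ.walkVal (W₁.append (P.append (W₂.append P.reverse))) = 1) (A : Subgroup Γ)
    (hA : ψ.walkVal W₁ ∈ A) : ∃ η : α → Γ, (ψ.switch η).valSet C ⊆ (A : Set Γ) := by
  -- The potentials are built successively on the first cycle, the path and the second cycle, each
  -- keeping the values of the previous one on the pieces already treated. The value at `u` is
  -- normalized to 1.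
  obtain ⟨f₁, hf₁u, -, hf₁⟩ := exists_switchedBy_mem_of_isSimpleClosed (ψ := ψ) h.left (S := ∅)
    (by simp) (fun _ => 1)
  obtain ⟨f₂, hf₂u, hf₂S, hf₂⟩ := exists_isConsistent_of_isPath (ψ := ψ) h.path
    (S := {x | x ∈ W₁.support}) (fun x hx hx' => by
      obtain rfl := h.path_left x (mem_support_of_mem_tailSupport hx) hx'
      exact h.path.start_notMem hx) f₁
  obtain ⟨f₃, hf₃v, hf₃S, hf₃⟩ := exists_switchedBy_mem_of_isSimpleClosed (ψ := ψ) h.right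
    (S := {x | x ∈ W₁.support} ∪ {x | x ∈ P.support}) (by
      rintro x hx (hx' | hx')
      · exact (h.left_right x hx' hx).2
      · exact h.path_right x hx' hx) f₂
  refine ⟨_, switch_inv_valSet_subset (h := f₃) fun e he a b hab => ?_⟩
  have hu : f₂ u = 1 := by rw [hf₂u, hf₁u]
  rw [h.eq_union] at he
  rcases he with (he | he) | he
  · have h2 := hf₁ A (by simpa [hf₁u] using hA) e he a b hab
    have h3 : ∀ x ∈ W₁.support, f₃ x = f₁ x := fun x hx => by
      rw [hf₃S x (Or.inl hx), hf₂S x hx]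
    rwa [switchedBy, h3 a (mem_support_of_isLink he hab),
      h3 b (mem_support_of_isLink he hab.symm)]
  · have h2 := hf₂.switchedBy_mem A he hab
    rwa [switchedBy, hf₃S a (Or.inr (mem_support_of_isLink he hab)),
      hf₃S b (Or.inr (mem_support_of_isLink he hab.symm))]
  · refine hf₃ A ?_ e he a b hab
    -- As `f₂ u = 1`, the gain of `P` is `f₂ v` and that of its reverse is `(f₂ v)⁻¹`. So `h1` makes
    -- the conjugate of the gain of `W₂` by `f₂ v` the inverse of the gain of `W₁`, which lies in
    -- `A`.
    have hp := hf₂.apply_eq P subset_rfl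
    have hq := hf₂.apply_eq P.reverse (fun e he => by simpa using he)
    rw [hu, one_mul] at hp
    rw [hu] at hq
    have hq' : ψ.walkVal P.reverse = (f₂ v)⁻¹ := eq_inv_of_mul_eq_one_right hq.symm
    have hval : ∀ {x y z : α} (D : Walk G x y) (D' : Walk G y z),
        ψ.walkVal (D.append D') = ψ.walkVal D * ψ.walkVal D' := by
      intro x y z D D'
      simp [walkVal]
    rw [hval, hval, hval, hq', ← hp] at h1
    rw [hf₃v, mul_assoc, eq_inv_of_mul_eq_one_right h1]
    exact A.inv_mem hA

end GainFunction

end potentials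

/-! ### Neutral circuits and the class of circuits defining the lift -/

namespace GainFunction

variable {α β Γ₁ : Type*} [CommGroup Γ₁] {G : Graph α β} {ψ : GainFunction G (SignedGroup Γ₁)}

lemma reflection_mul_self (a : Γ₁) : (⟨a, -1⟩ : SignedGroup Γ₁) * ⟨a, -1⟩ = 1 := by
  refine SemidirectProduct.ext ?_ (by simp [SemidirectProduct.mul_right])
  rw [SemidirectProduct.mul_left]
  change a * a ^ (-1 : ℤ) = 1
  simp

/-- The subgroup generated by a reflection. -/
def reflectionSubgroup (a : Γ₁) : Subgroup (SignedGroup Γ₁) where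
  carrier := {1, ⟨a, -1⟩}
  one_mem' := Or.inl rfl
  mul_mem' := by
    rintro x y (rfl | rfl) (rfl | rfl)
    · exact Or.inl (one_mul 1)
    · exact Or.inr (one_mul _)
    · exact Or.inr (mul_one _)
    · exact Or.inl (reflection_mul_self a)
  inv_mem' := by
    rintro x (rfl | rfl)
    · exact Or.inl inv_one
    · exact Or.inr (inv_eq_of_mul_eq_one_left (reflection_mul_self a))

/-- On circuits of `F`, neutrality means that a circuit walk has gain 1 in the full group, because
its sign is 1. This condition is compared with switching into a group of order two. -/
theorem isNeutral_iff_mem_linearClass {C : Set β} (hC : IsSignedCircuit G ψ.sign C) :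
    ψ.IsNeutral C ↔ C ∈ ψ.linearClass (translations Γ₁) (reflectionSubgroups Γ₁) := by
  constructor
  · intro hN
    refine ⟨quot_isFrameCircuit_iff.2 hC, ?_⟩
    rcases hC.cases with ⟨v, W, hW, rfl, h1⟩ | ⟨u, v, W₁, P, W₂, h, h₁, h₂⟩
    · refine Or.inl ⟨v, W, hW, rfl, ?_⟩
      rw [walkVal_eq_one_iff h1]
      exact (signedWalkGain_eq_one_iff_isNeutral hC
        (exists_isCircuitWalk_of_isPositiveCycle hW)).2 hN
    · refine Or.inr ⟨Or.inl h.isHandcuff, ?_⟩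
      have h3 := (signedWalkGain_eq_one_iff_isNeutral hC h.isCircuitWalk).2 hN
      rw [← walkVal_eq_one_iff (by simp [h₁, h₂, Int.units_mul_self])] at h3
      -- As `W₁` is negative, its gain is a reflection and generates a member of `𝒜`.
      obtain ⟨η, hη⟩ := exists_switch_valSet_subset h h3
        (reflectionSubgroup (ψ.walkVal W₁).left)
        (Or.inr (SemidirectProduct.ext rfl ((walkVal_right W₁).trans h₁)))
      exact ⟨η, _, ⟨_, rfl⟩, hη⟩
  · rintro ⟨-, ⟨v, W, hW, rfl, h1⟩ | ⟨-, η, A, ⟨a, hA⟩, hη⟩⟩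
    · refine ⟨v, W, exists_isCircuitWalk_of_isPositiveCycle hW, ?_⟩
      rw [signedWalkGain_eq, h1, SemidirectProduct.one_left]
    · obtain ⟨v, W, hW, h1⟩ := hC.exists_isCircuitWalk
      refine ⟨v, W, hW, ?_⟩
      rw [← walkVal_eq_one_iff h1]
      -- The switched gain of the circuit walk is 1 or a reflection. Its sign is 1, so it is 1, and
      -- so is its conjugate, the original gain.
      have h2 := mem_of_switch_valSet_subset hη W hW.1.subset
      rw [← SetLike.mem_coe, hA] at h2
      have h3 : ((η v)⁻¹ * ψ.walkVal W * η v).right = 1 := by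
        simp [walkVal_right, h1]
      rcases h2 with h2 | h2
      · have h4 : ψ.walkVal W = η v * ((η v)⁻¹ * ψ.walkVal W * η v) * (η v)⁻¹ := by group
        rw [h4, h2]
        simp
      · rw [h2] at h3
        simp at h3

end GainFunction

/-! ### Elementary lifts -/

section elementaryLifts

variable {β : Type*} {N : Matroid β} {X : Set β}

lemma natCast_toNat_eRk (hX : X.Finite) : ((N.eRk X).toNat : ℕ∞) = N.eRk X :=
  ENat.natCast_toNat ((N.eRk_le_encard X).trans_lt hX.encard_lt_top).ne

lemma rank_insert_bounds (hX : X.Finite) (e : β) :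
    rank N X ≤ rank N (insert e X) ∧ rank N (insert e X) ≤ rank N X + 1 := by
  have h1 := N.eRk_mono (Set.subset_insert e X)
  have h2 := N.eRk_insert_le_add_one e X
  rw [← natCast_toNat_eRk hX, ← natCast_toNat_eRk (hX.insert e)] at h1 h2
  rw [rank, rank]
  norm_cast at h1 h2 ⊢

lemma mem_closure_of_rank_insert_eq (hX : X.Finite) {e : β} (he : e ∈ N.E)
    (h : rank N (insert e X) = rank N X) : e ∈ N.closure X := by
  by_contra hcl
  have h1 := N.eRk_insert_eq_add_one ⟨he, hcl⟩
  rw [← natCast_toNat_eRk hX, ← natCast_toNat_eRk (hX.insert e)] at h1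
  rw [rank, rank] at h
  norm_cast at h1 h
  omega

lemma rank_insert_eq_of_mem_closure {e : β} (he : e ∈ N.closure X) :
    rank N (insert e X) = rank N X := by
  rw [rank, rank, ← N.eRk_closure_eq (insert e X), Matroid.closure_insert_eq_of_mem_closure he,
    N.eRk_closure_eq]

/-- A class of circuits satisfying a local closure property defines an elementary lift. -/
theorem exists_elementaryLift {E : Set β} (hNE : N.E = E) (hE : E.Finite) (𝒞 : Set (Set β))
    (h𝒞 : ∀ X ⊆ E, ∀ e ∈ N.closure X, ∀ f ∈ N.closure X,
      (∀ C ⊆ insert e X, N.IsCircuit C → C ∈ 𝒞) → (∀ C ⊆ insert f X, N.IsCircuit C → C ∈ 𝒞) →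
      ∀ C ⊆ insert e (insert f X), N.IsCircuit C → C ∈ 𝒞) :
    ∃ M, HasRankFunction E (liftRank N 𝒞) M := by
  classical
  subst hNE
  let δ : Set β → ℤ := fun X => if ∀ C ⊆ X, N.IsCircuit C → C ∈ 𝒞 then 0 else 1
  have hr : ∀ X ⊆ N.E, liftRank N 𝒞 X = rank N X + δ X := by
    intro X hX
    rw [liftRank]
    congr 1
    refine if_congr (forall_congr' fun C => ?_) rfl rfl
    rw [Matroid.restrict_isCircuit_iff hX]
    tauto
  have hδ0 : ∀ X, δ X = 0 ↔ ∀ C ⊆ X, N.IsCircuit C → C ∈ 𝒞 := by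
    intro X
    simp only [δ]
    split_ifs with h
    · exact iff_of_true rfl h
    · exact iff_of_false one_ne_zero h
  have hδ : ∀ X, δ X = 0 ∨ δ X = 1 := by
    intro X
    simp only [δ]
    split_ifs <;> simp
  have hmono : ∀ X Y, X ⊆ Y → δ X ≤ δ Y := by
    intro X Y hXY
    rcases hδ Y with h | h
    · have : δ X = 0 := (hδ0 X).2 fun C hC => (hδ0 Y).1 h C (hC.trans hXY)
      omega
    · rcases hδ X with h' | h' <;> omega
  refine exists_hasRankFunction hE ?_ (fun X hX e he => ?_) fun X hX e he f hf h1 h2 => ?_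
  · rw [hr ∅ (Set.empty_subset _), (hδ0 ∅).2]
    · simp [rank]
    · intro C hC hCc
      exact absurd hCc.nonempty (by simp [Set.subset_empty_iff.1 hC])
  · rw [hr X hX, hr _ (Set.insert_subset he hX)]
    obtain ⟨h1, h2⟩ := rank_insert_bounds (N := N) (hE.subset hX) e
    have h3 := hmono _ _ (Set.subset_insert e X)
    refine ⟨by omega, ?_⟩
    by_cases h4 : δ X = δ (insert e X)
    · omega
    -- If `δ` jumps, a circuit outside `𝒞` passes through `e`. Then `e` is in the closure of `X`, so
    -- the rank of `N` does not grow and the total increase is 1.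
    · have h5 : δ X = 0 ∧ δ (insert e X) = 1 := by
        rcases hδ X with h | h <;> rcases hδ (insert e X) with h' | h' <;> omega
      have h6 : ∃ C ⊆ insert e X, N.IsCircuit C ∧ C ∉ 𝒞 := by
        by_contra! h6
        have := (hδ0 _).2 h6
        omega
      obtain ⟨C, hCX, hC, hC𝒞⟩ := h6
      have heC : e ∈ C := by
        by_contra heC
        exact hC𝒞 ((hδ0 X).1 h5.1 C ((Set.subset_insert_iff_of_notMem heC).1 hCX) hC)
      have hcl : e ∈ N.closure X := by
        refine N.closure_subset_closure ?_ (hC.mem_closure_sdiff_singleton_of_mem heC)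
        rintro f ⟨hfC, hfe⟩
        exact (hCX hfC).resolve_left hfe
      rw [rank_insert_eq_of_mem_closure hcl, h5.1, h5.2]
      omega
  · have heX := Set.insert_subset he hX
    have hfX := Set.insert_subset hf hX
    have hefX := Set.insert_subset he hfX
    rw [hr _ heX, hr X hX] at h1
    rw [hr _ hfX, hr X hX] at h2
    rw [hr _ hefX, hr X hX]
    have h3 := (rank_insert_bounds (N := N) (hE.subset hX) e).1
    have h4 := (rank_insert_bounds (N := N) (hE.subset hX) f).1
    have h5 := hmono _ _ (Set.subset_insert e X)
    have h6 := hmono _ _ (Set.subset_insert f X)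
    have hecl := mem_closure_of_rank_insert_eq (hE.subset hX) he (by omega)
    have hfcl := mem_closure_of_rank_insert_eq (hE.subset hX) hf (by omega)
    have hrk : rank N (insert e (insert f X)) = rank N X := by
      rw [rank_insert_eq_of_mem_closure
        (N.closure_subset_closure (Set.subset_insert f X) hecl),
        rank_insert_eq_of_mem_closure hfcl]
    rw [hrk]
    congr 1
    rcases hδ X with h | h
    · rw [h, hδ0]
      exact h𝒞 X hX e hecl f hfcl ((hδ0 _).1 (by omega)) ((hδ0 _).1 (by omega))
    · have h7 := hmono X (insert e (insert f X))
        ((Set.subset_insert f X).trans (Set.subset_insert e _))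
      rcases hδ (insert e (insert f X)) with h' | h' <;> omega

end elementaryLifts

lemma theMatroid_spec {β : Type*} {P : Matroid β → Prop} (h : ∃ M, P M) : P (theMatroid P) :=
  Classical.epsilon_spec_aux _ P h

/-! ### The linear class property and comparison of the two rank functions -/

namespace GainFunction

variable {α β Γ₁ : Type*} [CommGroup Γ₁] {G : Graph α β} {ψ : GainFunction G (SignedGroup Γ₁)}

/-- Here the absence of elements of order 2 enters: elimination with circuit vectors, whose entries
may be ±2, determines gains only up to a factor 2. -/
lemma eq_zero_of_two_zsmul (hΓ₁ : ∀ a : Γ₁, orderOf a ≠ 2) {a : Additive Γ₁}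
    (h : (2 : ℤ) • a = 0) : a = 0 := by
  by_contra hne
  refine hΓ₁ a.toMul (orderOf_eq_prime ?_ hne)
  have h1 : (2 : ℕ) • a = 0 := by exact_mod_cast h
  exact h1

/-- The gains of all cycles in `X` vanish if the gains of the circuits do. -/
lemma chainGain_eq_zero (hΓ₁ : ∀ a : Γ₁, orderOf a ≠ 2) {X : Set β} (hX : X ⊆ G.edgeSet)
    (hN : ∀ C ⊆ X, IsSignedCircuit G ψ.sign C → ψ.IsNeutral C) (z : β →₀ ℤ)
    (hz : boundary G ψ.sign z = 0) (hzX : ∀ e, z e ≠ 0 → e ∈ X) : ψ.chainGain z = 0 := by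
  obtain ⟨n, hn⟩ : ∃ n, z.support.card < n := ⟨_, Nat.lt_succ_self _⟩
  induction n generalizing z with
  | zero => omega
  | succ n ih =>
    by_cases h0 : z = 0
    · simp [h0]
    obtain ⟨C, hC, hCz⟩ := exists_isSignedCircuit_of_boundary_eq_zero h0 hz
      fun e he => hX (hzX e he)
    obtain ⟨y, hy, hyC, hy2, hyu⟩ := hC.exists_vector
    have hyN : ψ.chainGain y = 0 :=
      (isNeutral_iff_chainGain hC hyu).1 (hN C (fun e he => hzX e (hCz e he)) hC)
    obtain ⟨e, he⟩ := hC.nonempty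
    obtain ⟨k, hk⟩ := hy2 e he
    -- Since `y e * k = 2`, this combination vanishes at `e`, and it creates no new support because
    -- `y` lives on a circuit in the support of `z`.
    have hsub : ∀ f, ((2 : ℤ) • z - (k * z e) • y) f ≠ 0 → z f ≠ 0 := by
      intro f hf hzf
      have hyf : y f = 0 := by
        by_contra hyf
        exact hCz f ((hyC f).1 hyf) hzf
      simp [hzf, hyf] at hf
    have h1 := ih ((2 : ℤ) • z - (k * z e) • y) (by simp [hz, hy])
      (fun f hf => hzX f (hsub f hf)) (by
        refine Nat.lt_of_lt_of_le (Finset.card_lt_card ?_) (Nat.lt_succ_iff.1 hn)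
        rw [Finset.ssubset_iff_of_subset]
        · refine ⟨e, by simpa using hCz e he, ?_⟩
          rw [Finsupp.notMem_support_iff]
          simp only [Finsupp.sub_apply, Finsupp.smul_apply, smul_eq_mul]
          linear_combination z e * hk
        · intro f hf
          rw [Finsupp.mem_support_iff] at hf ⊢
          exact hsub f hf)
    rw [map_sub, map_smul, map_smul, hyN, smul_zero, sub_zero] at h1
    exact eq_zero_of_two_zsmul hΓ₁ h1

/-- The neutral circuits form a linear class. -/
lemma isNeutral_of_subset_insert_insert (hΓ₁ : ∀ a : Γ₁, orderOf a ≠ 2) {N : Matroid β}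
    (hNE : N.E = G.edgeSet) (hN : ∀ C, N.IsCircuit C ↔ IsSignedCircuit G ψ.sign C) {X : Set β}
    (hX : X ⊆ G.edgeSet) {e f : β} (he : e ∈ N.closure X) (hf : f ∈ N.closure X)
    (h₁ : ∀ C ⊆ insert e X, N.IsCircuit C → ψ.IsNeutral C)
    (h₂ : ∀ C ⊆ insert f X, N.IsCircuit C → ψ.IsNeutral C) {C : Set β}
    (hCX : C ⊆ insert e (insert f X)) (hC : N.IsCircuit C) : ψ.IsNeutral C := by
  by_cases heX : e ∈ insert f X
  · rw [Set.insert_eq_of_mem heX] at hCX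
    exact h₂ C hCX hC
  by_cases hfX : f ∈ insert e X
  · rw [Set.insert_comm, Set.insert_eq_of_mem hfX] at hCX
    exact h₁ C hCX hC
  simp only [Set.mem_insert_iff, not_or] at heX hfX
  have hXE : X ⊆ N.E := hNE ▸ hX
  -- As `g` is in the closure of `X`, there is a circuit through `g` in `insert g X`. It is neutral,
  -- and its vector has an entry at `g` dividing 2, so it can eliminate `g` from twice any integral
  -- chain.
  have aux : ∀ {g : β}, g ∈ N.closure X → g ∉ X →
      (∀ C ⊆ insert g X, N.IsCircuit C → ψ.IsNeutral C) →
      ∃ (y : β →₀ ℤ) (k : ℤ), boundary G ψ.sign y = 0 ∧ (∀ a, y a ≠ 0 → a ∈ insert g X) ∧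
        ψ.chainGain y = 0 ∧ 2 = y g * k := by
    intro g hg hgX h
    obtain ⟨D, hDX, hD, hgD⟩ := Matroid.exists_isCircuit_of_mem_closure hg hgX
    have hDs := (hN D).1 hD
    obtain ⟨y, hy, hyD, hy2, hyu⟩ := hDs.exists_vector
    obtain ⟨k, hk⟩ := hy2 g hgD
    exact ⟨y, k, hy, fun a ha => hDX ((hyD a).1 ha),
      (isNeutral_iff_chainGain hDs hyu).1 (h D hDX hD), hk⟩
  obtain ⟨y₁, k, hy₁, hy₁X, hy₁N, hk⟩ := aux he heX.2 h₁
  obtain ⟨y₂, l, hy₂, hy₂X, hy₂N, hl⟩ := aux hf hfX.2 h₂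
  have hCs := (hN C).1 hC
  obtain ⟨z, hz, hzC, -, hzu⟩ := hCs.exists_vector
  rw [isNeutral_iff_chainGain hCs hzu]
  have hy₁f : y₁ f = 0 := by
    by_contra h
    simpa [hfX.1, hfX.2] using hy₁X f h
  have hy₂e : y₂ e = 0 := by
    by_contra h
    simpa [heX.1, heX.2] using hy₂X e h
  -- The coefficients cancel `e` and `f`; neither auxiliary vector reaches the other element, by
  -- `hy₁f` and `hy₂e`. What remains is a kernel vector in `X`, where all circuits are neutral.
  have h3 := chainGain_eq_zero (ψ := ψ) hΓ₁ hX
    (fun D hD hDs => h₁ D (hD.trans (Set.subset_insert e X)) ((hN D).2 hDs))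
    ((2 : ℤ) • z - (k * z e) • y₁ - (l * z f) • y₂) (by simp [hz, hy₁, hy₂]) (by
      intro a ha
      by_contra haX
      apply ha
      simp only [Finsupp.sub_apply, Finsupp.smul_apply, smul_eq_mul]
      by_cases hae : a = e
      · subst hae
        rw [hy₂e]
        linear_combination z a * hk
      by_cases haf : a = f
      · subst haf
        rw [hy₁f]
        linear_combination z a * hl
      have h4 : z a = 0 := by
        by_contra h
        simpa [hae, haf, haX] using hCX ((hzC a).1 h)
      have h5 : y₁ a = 0 := by
        by_contra h
        simpa [hae, haX] using hy₁X a h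
      have h6 : y₂ a = 0 := by
        by_contra h
        simpa [haf, haX] using hy₂X a h
      simp [h4, h5, h6])
  rw [map_sub, map_sub, map_smul, map_smul, map_smul, hy₁N, hy₂N, smul_zero, smul_zero, sub_zero,
    sub_zero] at h3
  exact eq_zero_of_two_zsmul hΓ₁ h3

variable (ψ) in
lemma quot_isFrameMatroid_frameMatroid (hG : G.edgeSet.Finite) :
    (ψ.quot (translations Γ₁)).IsFrameMatroid (ψ.quot (translations Γ₁)).frameMatroid := by
  obtain ⟨M, hME, hM, -⟩ := exists_signedMatroid G ψ.sign hG
  refine theMatroid_spec ⟨M, hME, fun C => ?_⟩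
  rw [hM, quot_isFrameCircuit_iff]

/-- A matroid is determined by its circuits, so the frame matroid is the matroid of the incidence
matrix, whose rank was computed from potentials. -/
lemma rank_frameMatroid (hG : G.edgeSet.Finite) {X : Set β} (hX : X ⊆ G.edgeSet) :
    rank (ψ.quot (translations Γ₁)).frameMatroid X =
      (verts G X).ncard - (ψ.quot (translations Γ₁)).numBalancedComponents X := by
  obtain ⟨M, hME, hM, hMr⟩ := exists_signedMatroid G ψ.sign hG
  obtain ⟨hFE, hF⟩ := ψ.quot_isFrameMatroid_frameMatroid hG
  have h : (ψ.quot (translations Γ₁)).frameMatroid = M := by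
    refine Matroid.ext_isCircuit (hFE.trans hME.symm) fun C _ => ?_
    rw [hF, hM, quot_isFrameCircuit_iff]
  have h1 := finrank_span_incidence (s := ψ.sign) (hG.subset hX) hX
  rw [h, hMr X hX, quot_numBalancedComponents, ← h1]
  push_cast
  ring

lemma gainSignedRank_eq (hG : G.edgeSet.Finite) {X : Set β} (hX : X ⊆ G.edgeSet) :
    ψ.gainSignedRank X = liftRank (ψ.quot (translations Γ₁)).frameMatroid
      (ψ.linearClass (translations Γ₁) (reflectionSubgroups Γ₁)) X := by
  classical
  obtain ⟨hFE, hF⟩ := ψ.quot_isFrameMatroid_frameMatroid hG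
  rw [gainSignedRank, liftRank, rank_frameMatroid hG hX]
  congr 1
  refine if_congr (forall_congr' fun C => ?_) rfl rfl
  rw [Matroid.restrict_isCircuit_iff (hFE ▸ hX)]
  refine forall_congr' fun hC => ?_
  rw [hF, quot_isFrameCircuit_iff] at hC
  exact isNeutral_iff_mem_linearClass hC.1

variable (ψ) in
lemma exists_hasRankFunction_liftRank (hΓ₁ : ∀ a : Γ₁, orderOf a ≠ 2) (hG : G.edgeSet.Finite) :
    ∃ M, HasRankFunction G.edgeSet (liftRank (ψ.quot (translations Γ₁)).frameMatroid
      (ψ.linearClass (translations Γ₁) (reflectionSubgroups Γ₁))) M := by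
  obtain ⟨hFE, hF⟩ := ψ.quot_isFrameMatroid_frameMatroid hG
  simp_rw [quot_isFrameCircuit_iff] at hF
  have hiff : ∀ {C}, (ψ.quot (translations Γ₁)).frameMatroid.IsCircuit C →
      (ψ.IsNeutral C ↔ C ∈ ψ.linearClass (translations Γ₁) (reflectionSubgroups Γ₁)) :=
    fun hC => isNeutral_iff_mem_linearClass ((hF _).1 hC)
  refine exists_elementaryLift hFE hG _ fun X hX e he f hf h₁ h₂ C hCX hC => ?_
  rw [← hiff hC]
  exact isNeutral_of_subset_insert_insert hΓ₁ hFE hF hX he hf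
    (fun D hDX hD => (hiff hD).2 (h₁ D hDX hD)) (fun D hDX hD => (hiff hD).2 (h₂ D hDX hD)) hCX hC

end GainFunction

end GainGraph

/-- The first, third and fourth part of the conclusion say that the three matroids in question are
well defined. -/
theorem mainTheorem8 {Γ₁ : Type*} [CommGroup Γ₁] (hΓ₁ : ∀ a : Γ₁, orderOf a ≠ 2)
    {α β : Type*} (G : Graph α β) (hG : G.edgeSet.Finite)
    (ψ : GainGraph.GainFunction G (GainGraph.SignedGroup Γ₁)) :
    (ψ.quot (GainGraph.translations Γ₁)).IsFrameMatroid
      (ψ.quot (GainGraph.translations Γ₁)).frameMatroid ∧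
    (∀ C : Set β, (ψ.quot (GainGraph.translations Γ₁)).frameMatroid.IsCircuit C →
      (ψ.IsNeutral C ↔
        C ∈ ψ.linearClass (GainGraph.translations Γ₁) (GainGraph.reflectionSubgroups Γ₁)) ∧
      (∀ (v : α) (W : GainGraph.Walk G v v), GainGraph.IsCircuitWalk C W →
        (ψ.signedWalkGain W = 1 ↔ ψ.IsNeutral C))) ∧
    GainGraph.HasRankFunction G.edgeSet
      (GainGraph.liftRank (ψ.quot (GainGraph.translations Γ₁)).frameMatroid
        (ψ.linearClass (GainGraph.translations Γ₁) (GainGraph.reflectionSubgroups Γ₁)))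
      (ψ.liftMatroid (GainGraph.translations Γ₁) (GainGraph.reflectionSubgroups Γ₁)) ∧
    GainGraph.HasRankFunction G.edgeSet ψ.gainSignedRank ψ.gainSignedMatroid ∧
    ψ.gainSignedMatroid =
      ψ.liftMatroid (GainGraph.translations Γ₁) (GainGraph.reflectionSubgroups Γ₁) := by
  obtain ⟨hFE, hF⟩ := ψ.quot_isFrameMatroid_frameMatroid hG
  have hlift := ψ.exists_hasRankFunction_liftRank hΓ₁ hG
  -- The rank functions are compared on subsets of the edge set only, which suffices for the two
  -- predicates on matroids to coincide. Both matroids are then chosen by the same predicate and are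
  -- equal.
  have heq : GainGraph.HasRankFunction G.edgeSet ψ.gainSignedRank =
      GainGraph.HasRankFunction G.edgeSet
        (GainGraph.liftRank (ψ.quot (GainGraph.translations Γ₁)).frameMatroid
          (ψ.linearClass (GainGraph.translations Γ₁) (GainGraph.reflectionSubgroups Γ₁))) := by
    funext M
    refine propext (and_congr_right fun _ => forall₂_congr fun X hX => ?_)
    rw [GainGraph.GainFunction.gainSignedRank_eq hG hX]
  refine ⟨⟨hFE, hF⟩, fun C hC => ?_, GainGraph.theMatroid_spec hlift,
    GainGraph.theMatroid_spec (heq ▸ hlift), ?_⟩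
  · have hC' := GainGraph.GainFunction.quot_isFrameCircuit_iff.1 ((hF C).1 hC)
    exact ⟨GainGraph.GainFunction.isNeutral_iff_mem_linearClass hC', fun v W hW =>
      GainGraph.GainFunction.signedWalkGain_eq_one_iff_isNeutral hC' hW⟩
  · rw [GainGraph.GainFunction.gainSignedMatroid, GainGraph.GainFunction.liftMatroid, heq]
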